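/- Conventions. A complex Banach lattice $E$ is the complexification $E=E_{\mathbb R}\oplus iE_{\mathbb R}$ of a real Banach lattice $E_{\mathbb R}$, with positive cone $E_+=(E_{\mathbb R})_+$, modulus $|x+iy|=\sup_{\theta}(x\cos\theta+y\sin\theta)$ and norm $\|z\|=\|\,|z|\,\|$. It is called atomic if for every $x\in E_{\mathbb R}$ with $x>0$ there is an atom $a$ with $0<a\le x$ (an atom being an $a>0$ such that every $b$ with $0\le b\le a$ is a scalar multiple of $a$). Its norm is order continuous if $x_\alpha\downarrow 0$ in $E_{\mathbb R}$ implies $\|x_\alpha\|\to 0$ for every net. A linear subspace $I$ is an order ideal if $|z|\le|w|$ and $w\in I$ imply $z\in I$. Let $U$ be a countably incomplete ultrafilter on a set, and let ${}^*E$ be the ultrapower of $E$ along $U$. The nonstandard hull of $E$ is $\widehat E=\mathrm{fin}({}^*E)/\mu(0)$, where $\mathrm{fin}({}^*E)$ consists of the elements of finite norm and $\mu(0)$ of those of infinitesimal norm; it is normed by $\|\hat x\|=\mathrm{st}\,\|x\|$ and ordered by the positive cone $\{\hat x : x\in{}^*(E_+)\cap\mathrm{fin}({}^*E)\}$. Regard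 $E$ as a closed subspace of $\widehat E$ through the constants, and let $\widetilde E=\widehat E/E$ carry the quotient norm and the quotient order, whose positive cone is the image of the positive cone of $\widehat E$. Proposition. Let $E$ be a complex Banach lattice. Then $\widetilde E$ is a complex Banach lattice (for the quotient norm and the quotient order) if and only if $E$ is atomic with order continuous norm. Likewise, $E$ is an order ideal in $\widehat E$ if and only if $E$ is atomic with order continuous norm. -/

import Mathlib

open Filter

universe u

noncomputable section

namespace NonstandardHull

/-! ### Real Banach lattices: atoms and order continuity of the norm -/

section RealLattice

variable {L : Type*} [NormedAddCommGroup L] [NormedSpace ℝ L] [Lattice L]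

/-- `a` is an atom of the vector lattice `L`: `a > 0` and the order interval `[0, a]` consists of
multiples of `a`. -/
def IsLatticeAtom (a : L) : Prop :=
  0 < a ∧ ∀ b : L, 0 ≤ b → b ≤ a → ∃ c : ℝ, b = c • a

variable (L)

/-- `L` is atomic (discrete): every `x > 0` dominates an atom. -/
def AtomicLattice : Prop :=
  ∀ x : L, 0 < x → ∃ a : L, IsLatticeAtom a ∧ a ≤ x

/-- The norm of `L` is order continuous: if a nonempty downward directed set `D` has infimum `0`,
then the norms of its elements become arbitrarily small. (By monotonicity of the norm on the
positive cone, this says that `x_α ↓ 0` implies `‖x_α‖ → 0` for every net.) -/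
def OrderContinuousNorm : Prop :=
  ∀ D : Set L, D.Nonempty → DirectedOn (fun x y => y ≤ x) D → IsGLB D 0 →
    ∀ ε : ℝ, 0 < ε → ∃ x ∈ D, ‖x‖ < ε

end RealLattice

/-! ### Complex Banach lattices -/

section ComplexLattice

/-- The complex normed space `Z` is, through the real-linear map `j : L → Z`, the complexification
of the real Banach lattice `L`: every `z : Z` is uniquely `x + iy` with `x, y ∈ L`, and
`‖x + iy‖ = ‖ |x + iy| ‖`, where `|x + iy| = sup_θ (x cos θ + y sin θ)`. -/
structure IsComplexification {L : Type*} [NormedAddCommGroup L] [NormedSpace ℝ L] [Lattice L]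
    {Z : Type*} [NormedAddCommGroup Z] [NormedSpace ℂ Z] (j : L →ₗ[ℝ] Z) : Prop where
  existsUnique_decomp : ∀ z : Z, ∃! p : L × L, z = j p.1 + Complex.I • j p.2
  norm_eq : ∀ x y : L, ∃ m : L,
    IsLUB (Set.range fun θ : ℝ => Real.cos θ • x + Real.sin θ • y) m ∧
      ‖j x + Complex.I • j y‖ = ‖m‖

/-- The complex normed space `Z`, ordered by the set `K` of its positive elements, is a complex
Banach lattice: it is the complexification of a real Banach lattice `L`, with `K = L₊`. -/
def IsComplexBanachLattice {Z : Type u} [NormedAddCommGroup Z] [NormedSpace ℂ Z]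
    (K : Set Z) : Prop :=
  ∃ (L : Type u) (_ : NormedAddCommGroup L) (_ : NormedSpace ℝ L) (_ : Lattice L)
    (_ : IsOrderedAddMonoid L) (_ : IsOrderedModule ℝ L) (_ : HasSolidNorm L)
    (_ : CompleteSpace L) (j : L →ₗ[ℝ] Z),
    IsComplexification j ∧ K = j '' {x : L | 0 ≤ x}

variable {Z : Type*} [AddCommGroup Z] [Module ℂ Z]

/-- `m` is the modulus `|z|` of `z` for the order `a ≤ b ↔ b - a ∈ K`: with `z = x + iy`, where `x`
and `y` are in the real part of `Z` (the real span of `K`), `m = sup_θ (x cos θ + y sin θ)`.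
(An upper bound of these elements automatically belongs to the real part.) -/
def IsModulus (K : Set Z) (z m : Z) : Prop :=
  ∃ x ∈ Submodule.span ℝ K, ∃ y ∈ Submodule.span ℝ K, z = x + Complex.I • y ∧
    (∀ θ : ℝ, m - (Real.cos θ • x + Real.sin θ • y) ∈ K) ∧
    ∀ u : Z, (∀ θ : ℝ, u - (Real.cos θ • x + Real.sin θ • y) ∈ K) → u - m ∈ K

/-- The subspace `I` is an order ideal for the positive cone `K`:
`|z| ≤ |w|` and `w ∈ I` imply `z ∈ I`. -/
def IsOrderIdeal (K : Set Z) (I : Submodule ℂ Z) : Prop :=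
  ∀ z w m n : Z, IsModulus K z m → IsModulus K w n → n - m ∈ K → w ∈ I → z ∈ I

end ComplexLattice

/-! ### Nonstandard hulls -/

/-- The ultrafilter `U` is countably incomplete. -/
def CountablyIncomplete {ι : Type*} (U : Ultrafilter ι) : Prop :=
  ∃ s : ℕ → Set ι, (∀ n, s n ∈ U) ∧ ⋂ n, s n = ∅

section Hull

variable {ι : Type*} (U : Ultrafilter ι) (X : Type*) [NormedAddCommGroup X]

/-- The nonstandard extension `*X` (with respect to `U`). -/
abbrev Star (X : Type*) : Type _ := Germ (U : Filter ι) X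

variable {U X} in
/-- The extension `*X → *ℝ` of the norm. -/
def starNorm (x : Star U X) : Star U ℝ := Germ.map (fun v : X => ‖v‖) x

variable {U X} in
lemma starNorm_coe (f : ι → X) :
    starNorm (U := U) (f : Star U X) = ((fun i => ‖f i‖ : ι → ℝ) : Star U ℝ) := rfl

variable {U X} in
lemma starNorm_nonneg (x : Star U X) : 0 ≤ starNorm x := by
  induction x using Germ.inductionOn with
  | _ f => exact Germ.coe_le.2 (Eventually.of_forall fun i => norm_nonneg (f i))

variable {U X} in
lemma starNorm_add_le (x y : Star U X) : starNorm (x + y) ≤ starNorm x + starNorm y := by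
  induction x, y using Germ.inductionOn₂ with
  | _ f g => exact Germ.coe_le.2 (Eventually.of_forall fun i => norm_add_le (f i) (g i))

variable [NormedSpace ℂ X]

variable {U X} in
lemma starNorm_smul (c : ℂ) (x : Star U X) :
    starNorm (c • x) = ((‖c‖ : ℝ) : Star U ℝ) * starNorm x := by
  induction x using Germ.inductionOn with
  | _ f => exact Germ.coe_eq.2 (Eventually.of_forall fun i => norm_smul c (f i))

/-- `fin(*X)`: the elements of finite norm. -/
def finite : Submodule ℂ (Star U X) where
  carrier := {x | ∃ r : ℝ, starNorm x ≤ (r : Star U ℝ)}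
  zero_mem' := ⟨0, Germ.coe_le.2 (Eventually.of_forall fun i => by simp)⟩
  add_mem' := by
    rintro x y ⟨r, hr⟩ ⟨s, hs⟩
    exact ⟨r + s, (starNorm_add_le x y).trans (add_le_add hr hs)⟩
  smul_mem' := by
    rintro c x ⟨r, hr⟩
    refine ⟨‖c‖ * r, ?_⟩
    induction x using Germ.inductionOn with
    | _ f =>
      have h : ∀ᶠ i in (U : Filter ι), ‖f i‖ ≤ r := Germ.coe_le.1 hr
      refine Germ.coe_le.2 (h.mono fun i hi => ?_)
      simpa [norm_smul] using mul_le_mul_of_nonneg_left hi (norm_nonneg c)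

/-- `μ(0)`: the elements of infinitesimal norm. -/
def monad : Submodule ℂ (finite U X) where
  carrier := {x | ∀ ε : ℝ, 0 < ε → starNorm (x : Star U X) ≤ (ε : Star U ℝ)}
  zero_mem' := fun ε hε => Germ.coe_le.2 (Eventually.of_forall fun i => by simpa using hε.le)
  add_mem' := by
    rintro x y hx hy ε hε
    have h := add_le_add (hx (ε / 2) (half_pos hε)) (hy (ε / 2) (half_pos hε))
    rw [show ((ε / 2 : ℝ) : Star U ℝ) + ((ε / 2 : ℝ) : Star U ℝ) = ((ε / 2 + ε / 2 : ℝ) : Star U ℝ)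
      from rfl, add_halves] at h
    exact (starNorm_add_le _ _).trans h
  smul_mem' := by
    rintro c ⟨x, hx'⟩ hx ε hε
    have hc : 0 < ‖c‖ + 1 := by positivity
    have h := hx (ε / (‖c‖ + 1)) (by positivity)
    clear hx
    induction x using Germ.inductionOn with
    | _ f =>
      have h : ∀ᶠ i in (U : Filter ι), ‖f i‖ ≤ ε / (‖c‖ + 1) := Germ.coe_le.1 h
      refine Germ.coe_le.2 (h.mono fun i hi => ?_)
      have h2 := (le_div_iff₀ hc).1 hi
      have : ‖c • f i‖ ≤ ε := by
        rw [norm_smul]; nlinarith [norm_nonneg (f i)]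
      exact this

/-- The nonstandard hull `X̂ = fin(*X) / μ(0)`. -/
def Hull : Type _ := finite U X ⧸ monad U X

instance : AddCommGroup (Hull U X) := inferInstanceAs (AddCommGroup (finite U X ⧸ monad U X))

instance : Module ℂ (Hull U X) := inferInstanceAs (Module ℂ (finite U X ⧸ monad U X))

/-- The class `x̂` of `x ∈ fin(*X)`. -/
def Hull.mk : finite U X →ₗ[ℂ] Hull U X := (monad U X).mkQ

lemma Hull.mk_surjective : Function.Surjective (Hull.mk U X) := (monad U X).mkQ_surjective

variable {U X} in
lemma Hull.mk_eq_zero {x : finite U X} : Hull.mk U X x = 0 ↔ x ∈ monad U X :=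
  Submodule.Quotient.mk_eq_zero _

/-- The embedding of `ℝ` into `*ℝ`. -/
def constHom : ℝ →+*o Star U ℝ where
  toFun r := (r : Star U ℝ)
  map_one' := rfl
  map_mul' _ _ := rfl
  map_zero' := rfl
  map_add' _ _ := rfl
  monotone' _ _ h := Germ.const_le h

variable {U X} in
/-- The standard part of the norm of an element of `fin(*X)`. -/
def stNorm (x : finite U X) : ℝ := ArchimedeanClass.stdPart (starNorm (x : Star U X))

variable {U X} in
lemma starNorm_finite (x : finite U X) :
    0 ≤ ArchimedeanClass.mk (starNorm (x : Star U X)) := by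
  obtain ⟨r, hr⟩ := x.2
  exact ArchimedeanClass.mk_nonneg_of_le_of_le_of_archimedean (constHom U) (r := 0) (s := r)
    (by simpa using starNorm_nonneg (x : Star U X)) hr

variable {U X} in
lemma stNorm_nonneg (x : finite U X) : 0 ≤ stNorm x :=
  ArchimedeanClass.stdPart_nonneg (starNorm_nonneg _)

variable {U X} in
lemma stNorm_add_le (x y : finite U X) : stNorm (x + y) ≤ stNorm x + stNorm y := by
  rw [stNorm, stNorm, stNorm, ← ArchimedeanClass.stdPart_add (starNorm_finite x)
    (starNorm_finite y)]
  refine ArchimedeanClass.stdPart_monotoneOn (starNorm_finite (x + y)) ?_ (starNorm_add_le _ _)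
  exact (le_min (starNorm_finite x) (starNorm_finite y)).trans (ArchimedeanClass.min_le_mk_add _ _)

variable {U X} in
lemma stNorm_smul (c : ℂ) (x : finite U X) : stNorm (c • x) = ‖c‖ * stNorm x := by
  have h : starNorm ((c • x : finite U X) : Star U X) =
      constHom U ‖c‖ * starNorm (x : Star U X) := starNorm_smul c _
  rw [stNorm, h, ArchimedeanClass.stdPart_mul
    (ArchimedeanClass.mk_map_nonneg_of_archimedean (constHom U) _) (starNorm_finite x),
    ArchimedeanClass.stdPart_map_real, stNorm]

variable {U X} in
lemma stNorm_eq_zero {x : finite U X} : stNorm x = 0 ↔ x ∈ monad U X := by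
  constructor
  · intro h ε hε
    exact (ArchimedeanClass.lt_of_stdPart_lt (constHom U) (starNorm_finite x)
      (lt_of_eq_of_lt h hε)).le
  · intro h
    refine le_antisymm (le_of_forall_pos_le_add fun ε hε => ?_) (stNorm_nonneg x)
    rw [zero_add]
    exact ArchimedeanClass.stdPart_le_of_le (constHom U) (starNorm_finite x) (h ε hε)

variable {U X} in
lemma stNorm_congr {x y : finite U X} (h : x - y ∈ monad U X) : stNorm x = stNorm y := by
  have key : ∀ a b : finite U X, a - b ∈ monad U X → stNorm a ≤ stNorm b := by
    intro a b hab
    have h1 := stNorm_add_le (a - b) b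
    rwa [sub_add_cancel, stNorm_eq_zero.2 hab, zero_add] at h1
  exact le_antisymm (key x y h) (key y x (by simpa using (monad U X).neg_mem h))

/-- The norm of the hull: `‖x̂‖` is the standard part of `‖x‖`. -/
instance : Norm (Hull U X) where
  norm := Quotient.lift (fun x : finite U X => stNorm x) fun _ _ h =>
    stNorm_congr ((Submodule.quotientRel_def _).1 h)

variable {U X} in
lemma Hull.norm_mk (x : finite U X) : ‖Hull.mk U X x‖ = stNorm x := rfl

lemma Hull.core : NormedSpace.Core ℂ (Hull U X) where
  norm_nonneg a := by
    obtain ⟨x, rfl⟩ := Hull.mk_surjective U X a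
    exact stNorm_nonneg x
  norm_smul c a := by
    obtain ⟨x, rfl⟩ := Hull.mk_surjective U X a
    rw [← map_smul, Hull.norm_mk, Hull.norm_mk, stNorm_smul]
  norm_triangle a b := by
    obtain ⟨x, rfl⟩ := Hull.mk_surjective U X a
    obtain ⟨y, rfl⟩ := Hull.mk_surjective U X b
    rw [← map_add]
    exact stNorm_add_le x y
  norm_eq_zero_iff a := by
    obtain ⟨x, rfl⟩ := Hull.mk_surjective U X a
    rw [Hull.norm_mk, stNorm_eq_zero, Hull.mk_eq_zero]

instance : NormedAddCommGroup (Hull U X) := NormedAddCommGroup.ofCore (Hull.core U X)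

instance : NormedSpace ℂ (Hull U X) := NormedSpace.ofCore (Hull.core U X)

/-- The constant embedding `X → fin(*X)`. -/
def constFinite : X →ₗ[ℂ] finite U X where
  toFun x := ⟨(x : Star U X), ‖x‖, le_refl _⟩
  map_add' _ _ := rfl
  map_smul' _ _ := rfl

/-- The canonical isometric embedding `X → X̂`. -/
def Hull.of : X →ₗᵢ[ℂ] Hull U X where
  toLinearMap := (Hull.mk U X).comp (constFinite U X)
  norm_map' x := ArchimedeanClass.stdPart_map_real (constHom U) ‖x‖

/-- `X` viewed as a subspace of `X̂`. -/
def standardPart : Submodule ℂ (Hull U X) := LinearMap.range (Hull.of U X).toLinearMap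

instance [CompleteSpace X] : IsClosed (standardPart U X : Set (Hull U X)) := by
  have h := (Hull.of U X).isometry.isClosedEmbedding.isClosed_range
  have e : (standardPart U X : Set (Hull U X)) = Set.range (Hull.of U X) := by
    ext a; simp [standardPart]
  rwa [e]

/-- `X̃ = X̂ / X`, with the quotient norm. -/
abbrev Tilde : Type _ := Hull U X ⧸ standardPart U X

variable {X} in
/-- The positive cone of `X̂` when `P` is the positive cone of `X`: the classes of the elements
of `*P` of finite norm. -/
def Hull.cone (P : Set X) : Set (Hull U X) :=
  Hull.mk U X '' {x | Germ.LiftPred (fun v : X => v ∈ P) (x : Star U X)}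

variable {X} in
/-- The quotient order on `X̃`: its positive cone is the image of that of `X̂`. -/
def Tilde.cone (P : Set X) : Set (Tilde U X) :=
  (standardPart U X).mkQ '' Hull.cone U P

end Hull

end NonstandardHull

end

set_option linter.unusedSectionVars false

noncomputable section

namespace NonstandardHull

/-! ### Directed sets and minimal elements in compact sets. -/

section Compactness

variable {X : Type*} [TopologicalSpace X] [Preorder X]

/-! The pivot is norm compactness of all order intervals of the real part `L` (`CompactIntervals`).
It is equivalent to atomicity with order continuous norm (`compactIntervals_iff`), and each of the
two conditions on the hull is equivalent to it.

Compact intervals give order continuity because a directed set in a compact interval has a bound in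
its closure. They give atoms by a Lyapunov-type argument: if x > 0 were a disjoint sum of
arbitrarily small pieces, a suitable choice of pieces would halve x up to small error on any finite
set of functionals, while no component c of x satisfies 2c = x (`exists_not_isDisjointSum`). A
minimal component that is not a disjoint sum of small pieces is then an atom
(`exists_isLatticeAtom_le`). Conversely, in the atomic order continuous case x is a norm limit of
finite sums of multiples of atoms below it, whose intervals are compact.

For the hull, elements are represented by pairs of bounded families in `L`; the standard ones come
from families converging along U. With compact intervals the convergent families form a closed
lattice ideal (`isLatticeIdeal_convergentFamilies`), which gives the order ideal property. The space
Ẽ is then the complexification of the quotient of the bounded families by this ideal; the modulus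
norm is matched by truncating in finitely many directions (`exists_forall_dir_le`). Conversely,
either condition forces every family in [0, x] to converge along U, and countable incompleteness
turns this into sequential compactness of [0, x]. -/

lemma IsCompact.exists_upperBound_mem_closure [ClosedIciTopology X] {K S : Set X}
    (hK : IsCompact K) (hSK : S ⊆ K) (hK' : IsClosed K) (hne : S.Nonempty)
    (hdir : DirectedOn (· ≤ ·) S) : ∃ a ∈ closure S, ∀ s ∈ S, s ≤ a := by
  have : Nonempty S := hne.to_subtype
  have hsub : ∀ s : S, closure (S ∩ Set.Ici (s : X)) ⊆ K := fun s =>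
    hK'.closure_subset_iff.2 (Set.inter_subset_left.trans hSK)
  -- The closures of the tails S ∩ [s, ∞) are nonempty, compact and directed; a common point is a
  -- limit of S lying above all of S.
  obtain ⟨a, ha⟩ := IsCompact.nonempty_iInter_of_directed_nonempty_isCompact_isClosed
    (fun s : S => closure (S ∩ Set.Ici (s : X))) (by
      intro s t
      obtain ⟨r, hr, hsr, htr⟩ := hdir s s.2 t t.2
      exact ⟨⟨r, hr⟩, closure_mono fun z hz => ⟨hz.1, hsr.trans hz.2⟩,
        closure_mono fun z hz => ⟨hz.1, htr.trans hz.2⟩⟩)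
    (fun s => ⟨s, subset_closure ⟨s.2, le_refl (s : X)⟩⟩)
    (fun s => hK.of_isClosed_subset isClosed_closure (hsub s))
    (fun s => isClosed_closure)
  rw [Set.mem_iInter] at ha
  obtain ⟨s₀, hs₀⟩ := hne
  refine ⟨a, closure_mono Set.inter_subset_left (ha ⟨s₀, hs₀⟩), fun s hs => ?_⟩
  exact (isClosed_Ici.closure_subset_iff.2 Set.inter_subset_right) (ha ⟨s, hs⟩)

lemma IsCompact.exists_lowerBound_mem_closure [ClosedIicTopology X] {K S : Set X}
    (hK : IsCompact K) (hSK : S ⊆ K) (hK' : IsClosed K) (hne : S.Nonempty)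
    (hdir : DirectedOn (fun x y => y ≤ x) S) : ∃ a ∈ closure S, ∀ s ∈ S, a ≤ s :=
  IsCompact.exists_upperBound_mem_closure (X := Xᵒᵈ) hK hSK hK' hne hdir

lemma IsCompact.exists_minimal_mem [ClosedIicTopology X] {K : Set X}
    (hK : IsCompact K) (hK' : IsClosed K) (hne : K.Nonempty) : ∃ m, Minimal (· ∈ K) m := by
  refine zorn_le₀ (α := Xᵒᵈ) K fun c hc hchain => ?_
  obtain rfl | hcne := c.eq_empty_or_nonempty
  · obtain ⟨k, hk⟩ := hne
    exact ⟨k, hk, by simp⟩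
  · obtain ⟨a, ha, hab⟩ := IsCompact.exists_upperBound_mem_closure (X := Xᵒᵈ) hK hc hK' hcne
      hchain.directedOn
    exact ⟨a, hK'.closure_subset_iff.2 hc ha, hab⟩

end Compactness

/-! ### Riesz decomposition, disjointness and components in lattice ordered groups. -/

section LatticeGroup

variable {G : Type*} [AddCommGroup G] [Lattice G] [IsOrderedAddMonoid G]

lemma inf_add_le_add_inf {d a b : G} (hd : 0 ≤ d) (ha : 0 ≤ a) (hb : 0 ≤ b) :
    d ⊓ (a + b) ≤ d ⊓ a + d ⊓ b := by
  rw [add_inf]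
  refine le_inf (inf_le_left.trans (le_add_of_nonneg_left (le_inf hd ha))) ?_
  rw [inf_add]
  exact le_inf (inf_le_left.trans (le_add_of_nonneg_right hb)) inf_le_right

/-- The Riesz decomposition property, with y ⊓ a as first summand. -/
lemma exists_add_eq_of_le_add {y a b : G} (hy : 0 ≤ y) (ha : 0 ≤ a) (hb : 0 ≤ b)
    (h : y ≤ a + b) : ∃ y₁ y₂, 0 ≤ y₁ ∧ y₁ ≤ a ∧ 0 ≤ y₂ ∧ y₂ ≤ b ∧ y₁ + y₂ = y := by
  refine ⟨y ⊓ a, y - y ⊓ a, le_inf hy ha, inf_le_right, sub_nonneg.2 inf_le_left, ?_,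
    add_sub_cancel _ _⟩
  rw [sub_le_iff_le_add, add_inf]
  exact le_inf (le_add_of_nonneg_left hb) (h.trans (add_comm a b).le)

lemma inf_add_eq_zero {d a b : G} (hd : 0 ≤ d) (ha : 0 ≤ a) (hb : 0 ≤ b)
    (h₁ : d ⊓ a = 0) (h₂ : d ⊓ b = 0) : d ⊓ (a + b) = 0 :=
  le_antisymm ((inf_add_le_add_inf hd ha hb).trans (by rw [h₁, h₂, add_zero]))
    (le_inf hd (add_nonneg ha hb))

lemma eq_inf_add_inf_of_le_add {d a b : G} (hd : 0 ≤ d) (ha : 0 ≤ a) (hb : 0 ≤ b)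
    (hab : a ⊓ b = 0) (h : d ≤ a + b) : d = d ⊓ a + d ⊓ b := by
  refine le_antisymm ((le_inf le_rfl h).trans (inf_add_le_add_inf hd ha hb)) ?_
  rw [← inf_add_sup]
  have h₀ : d ⊓ a ⊓ (d ⊓ b) ≤ 0 := hab ▸ inf_le_inf inf_le_right inf_le_right
  calc _ ≤ 0 + d := add_le_add h₀ (sup_le inf_le_left inf_le_left)
    _ = d := zero_add d

lemma inf_eq_zero_of_le {a b a' b' : G} (ha : 0 ≤ a) (hb : 0 ≤ b) (haa : a ≤ a') (hbb : b ≤ b')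
    (h : a' ⊓ b' = 0) : a ⊓ b = 0 :=
  le_antisymm (h ▸ inf_le_inf haa hbb) (le_inf ha hb)

/-- `c` is a component of `x`: `c` and `x - c` are disjoint. -/
def IsComponent (x c : G) : Prop := c ⊓ (x - c) = 0

namespace IsComponent

variable {x c d : G}

lemma nonneg (h : IsComponent x c) : 0 ≤ c := h ▸ inf_le_left

lemma sub_nonneg (h : IsComponent x c) : 0 ≤ x - c := h ▸ inf_le_right

lemma le (h : IsComponent x c) : c ≤ x := _root_.sub_nonneg.1 h.sub_nonneg

lemma compl (h : IsComponent x c) : IsComponent x (x - c) := by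
  rw [IsComponent, sub_sub_cancel, inf_comm]; exact h

lemma trans (h : IsComponent x c) (hd : IsComponent c d) : IsComponent x d := by
  have : x - d = (x - c) + (c - d) := by abel
  rw [IsComponent, this]
  exact inf_add_eq_zero hd.nonneg h.sub_nonneg hd.sub_nonneg
    (inf_eq_zero_of_le hd.nonneg h.sub_nonneg hd.le le_rfl h) hd

lemma add {y a b : G} (ha : IsComponent x a) (hb : IsComponent y b) (h : x ⊓ y = 0) :
    IsComponent (x + y) (a + b) := by
  have e : x + y - (a + b) = (x - a) + (y - b) := by abel
  have hx : x - a ≤ x := sub_le_self _ ha.nonneg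
  have hy : y - b ≤ y := sub_le_self _ hb.nonneg
  rw [IsComponent, e]
  refine inf_add_eq_zero (add_nonneg ha.nonneg hb.nonneg) ha.sub_nonneg hb.sub_nonneg ?_ ?_
  · rw [inf_comm]
    exact inf_add_eq_zero ha.sub_nonneg ha.nonneg hb.nonneg (by rw [inf_comm]; exact ha)
      (inf_eq_zero_of_le ha.sub_nonneg hb.nonneg hx hb.le h)
  · rw [inf_comm]
    refine inf_add_eq_zero hb.sub_nonneg ha.nonneg hb.nonneg ?_ (by rw [inf_comm]; exact hb)
    rw [inf_comm]
    exact inf_eq_zero_of_le ha.nonneg hb.sub_nonneg ha.le hy h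

end IsComponent

end LatticeGroup

/-! ### Compact order intervals, atoms and order continuity. -/

section Atoms

variable {L : Type*} [NormedAddCommGroup L] [NormedSpace ℝ L] [Lattice L] [IsOrderedAddMonoid L]
  [IsOrderedModule ℝ L] [HasSolidNorm L]

lemma isClosed_setOf_isComponent (x : L) : IsClosed {c : L | IsComponent x c} :=
  isClosed_eq (continuous_id.inf (continuous_const.sub continuous_id)) continuous_const

/-- Take b in [0, y] that is not a multiple of y. The positive parts of b - ty and ty - b are
disjoint. If one of them vanished for every t in [0, 1], the closed sets {ty ≤ b} and {b ≤ ty} would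
cover [0, 1], and by connectedness they would meet at some t with b = ty. -/
lemma exists_disjoint_of_not_isLatticeAtom {y : L} (hy : 0 < y) (h : ¬ IsLatticeAtom y) :
    ∃ u v : L, 0 < u ∧ 0 < v ∧ u ≤ y ∧ v ≤ y ∧ u ⊓ v = 0 := by
  simp only [IsLatticeAtom, hy, true_and, not_forall, not_exists] at h
  obtain ⟨b, hb, hby, hne⟩ := h
  by_contra! hcon
  have hcont : Continuous fun t : ℝ => t • y := by fun_prop
  have hcl : IsClosed {t : ℝ | t • y ≤ b} := isClosed_le hcont continuous_const
  have hcl' : IsClosed {t : ℝ | b ≤ t • y} := isClosed_le continuous_const hcont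
  obtain ⟨t, -, ht, ht'⟩ := isPreconnected_closed_iff.1 (isPreconnected_Icc (a := (0 : ℝ)) (b := 1))
    _ _ hcl hcl' (by
      rintro t ⟨h0, h1⟩
      by_contra hn
      simp only [Set.mem_union, Set.mem_ofPred_eq, not_or] at hn
      have hty : t • y ≤ y := by simpa using smul_le_smul_of_nonneg_right h1 hy.le
      have hty0 : 0 ≤ t • y := smul_nonneg h0 hy.le
      refine hcon (b - b ⊓ t • y) (t • y - b ⊓ t • y)
        (lt_of_le_of_ne (sub_nonneg.2 inf_le_left) fun e => ?_)
        (lt_of_le_of_ne (sub_nonneg.2 inf_le_right) fun e => ?_)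
        ((sub_le_self _ (le_inf hb hty0)).trans hby) ((sub_le_self _ (le_inf hb hty0)).trans hty) ?_
      · exact hn.2 (inf_eq_left.1 (sub_eq_zero.1 e.symm).symm)
      · exact hn.1 (inf_eq_right.1 (sub_eq_zero.1 e.symm).symm)
      · rw [← inf_sub, sub_self])
    ⟨0, by simp, by simpa using hb⟩ ⟨1, by simp, by simpa using hby⟩
  exact hne t (le_antisymm ht' ht)

/-- Finite sums of pairwise disjoint positive elements of norm less than `ε`. -/
inductive IsDisjointSum (ε : ℝ) : L → Prop
  | of_norm_lt {a : L} : 0 ≤ a → ‖a‖ < ε → IsDisjointSum ε a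
  | add {a b : L} : IsDisjointSum ε a → IsDisjointSum ε b → a ⊓ b = 0 → IsDisjointSum ε (a + b)

namespace IsDisjointSum

variable {ε : ℝ}

lemma nonneg {a : L} (h : IsDisjointSum ε a) : 0 ≤ a := by
  induction h with
  | of_norm_lt h _ => exact h
  | add _ _ _ h₁ h₂ => exact add_nonneg h₁ h₂

lemma mono {a d : L} (h : IsDisjointSum ε a) (hd : 0 ≤ d) (hda : d ≤ a) : IsDisjointSum ε d := by
  induction h generalizing d with
  | @of_norm_lt a ha hn =>
    refine .of_norm_lt hd (lt_of_le_of_lt (norm_le_norm_of_abs_le_abs ?_) hn)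
    rwa [abs_of_nonneg hd, abs_of_nonneg ha]
  | @add a b ha hb hab iha ihb =>
    rw [eq_inf_add_inf_of_le_add hd ha.nonneg hb.nonneg hab hda]
    have h₁ := le_inf hd ha.nonneg
    have h₂ := le_inf hd hb.nonneg
    exact .add (iha h₁ inf_le_right) (ihb h₂ inf_le_right)
      (inf_eq_zero_of_le h₁ h₂ inf_le_right inf_le_right hab)

/-- Split d into d ⊓ c and d - d ⊓ c. The second part is below |d - c|, hence small, and below x -
c, hence disjoint from the first. This makes the set of components that are not small sums closed.
-/
lemma of_norm_sub_lt {x c d : L} (hc : IsComponent x c) (hd : IsComponent x d)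
    (h : IsDisjointSum ε c) (hcd : ‖d - c‖ < ε) : IsDisjointSum ε d := by
  have h₁ : 0 ≤ d - d ⊓ c := sub_nonneg.2 inf_le_left
  have h₂ := le_inf hd.nonneg hc.nonneg
  have h₃ : d - d ⊓ c ≤ |d - c| := by
    rw [sub_inf, sub_self]
    exact sup_le (abs_nonneg _) (le_abs_self _)
  have h₄ : d - d ⊓ c ≤ x - c := by
    rw [sub_inf, sub_self]
    exact sup_le hc.sub_nonneg (sub_le_sub_right hd.le _)
  have := IsDisjointSum.add (h.mono h₂ inf_le_right) (.of_norm_lt (ε := ε) h₁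
    (lt_of_le_of_lt (norm_le_norm_of_abs_le_abs (by rwa [abs_of_nonneg h₁])) hcd))
    (inf_eq_zero_of_le h₂ h₁ inf_le_right h₄ hc)
  rwa [add_sub_cancel] at this

/-- Halving a disjoint sum of small elements, up to a small error on finitely many functionals. -/
lemma exists_isComponent_sum_sq_le {c : L} (h : IsDisjointSum ε c) (s : Finset (L →L[ℝ] ℝ))
    {M : ℝ} (hM : ∀ φ ∈ s, ‖φ‖ ≤ M) :
    ∃ r, IsComponent c r ∧ ∃ y : (L →L[ℝ] ℝ) → L, (∀ φ, |y φ| ≤ c) ∧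
      ∑ φ ∈ s, φ ((2 : ℝ) • r - c) ^ 2 ≤ ε * M * ∑ φ ∈ s, φ (y φ) := by
  induction h with
  | @of_norm_lt c hc hn =>
    -- A single small piece is kept whole. The sign makes φ (y φ) = |φ c|, so the bound is |φ c|² ≤
    -- εM|φ c|; stated through y, the right side is additive over disjoint pieces.
    refine ⟨c, by simp [IsComponent, hc], fun φ => if 0 ≤ φ c then c else -c, fun φ => ?_, ?_⟩
    · dsimp only
      split_ifs <;> simp [abs_of_nonneg hc]
    · rw [Finset.mul_sum]
      refine Finset.sum_le_sum fun φ hφ => ?_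
      have e : φ (if 0 ≤ φ c then c else -c) = |φ c| := by
        split_ifs with h
        · exact (abs_of_nonneg h).symm
        · rw [map_neg, abs_of_neg (not_le.1 h)]
      have e' : (2 : ℝ) • c - c = c := by rw [two_smul]; abel
      rw [e, e', ← sq_abs, sq]
      refine mul_le_mul_of_nonneg_right ?_ (abs_nonneg _)
      have := φ.le_opNorm c
      rw [Real.norm_eq_abs] at this
      calc |φ c| ≤ ‖φ‖ * ‖c‖ := this
        _ ≤ M * ε := mul_le_mul (hM φ hφ) hn.le (norm_nonneg _) ((norm_nonneg _).trans (hM φ hφ))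
        _ = ε * M := mul_comm _ _
  | @add a b ha hb hab iha ihb =>
    obtain ⟨r, hr, y, hy, hry⟩ := iha
    obtain ⟨t, ht, z, hz, htz⟩ := ihb
    have hyz : ∀ φ, |y φ + z φ| ≤ a + b := fun φ =>
      (abs_add_le _ _).trans (add_le_add (hy φ) (hz φ))
    have key : ∀ t', IsComponent b t' → ∑ φ ∈ s, φ ((2 : ℝ) • t' - b) ^ 2 ≤
        ε * M * ∑ φ ∈ s, φ (z φ) →
        ∑ φ ∈ s, φ ((2 : ℝ) • r - a) * φ ((2 : ℝ) • t' - b) ≤ 0 →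
        ∑ φ ∈ s, φ ((2 : ℝ) • (r + t') - (a + b)) ^ 2 ≤ ε * M * ∑ φ ∈ s, φ (y φ + z φ) := by
      intro t' _ h₁ h₂
      have e : ∀ φ : L →L[ℝ] ℝ, φ ((2 : ℝ) • (r + t') - (a + b)) ^ 2 =
          φ ((2 : ℝ) • r - a) ^ 2 + φ ((2 : ℝ) • t' - b) ^ 2 +
            2 * (φ ((2 : ℝ) • r - a) * φ ((2 : ℝ) • t' - b)) := by
        intro φ; simp only [map_sub, map_smul, map_add, smul_eq_mul]; ring
      simp only [e, map_add, Finset.sum_add_distrib, mul_add, ← Finset.mul_sum]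
      linarith
    -- Replacing t by b - t changes the sign of every φ(2t - b), so one of the two choices makes the
    -- cross term nonpositive.
    rcases le_total (∑ φ ∈ s, φ ((2 : ℝ) • r - a) * φ ((2 : ℝ) • t - b)) 0 with h0 | h0
    · exact ⟨r + t, hr.add ht hab, fun φ => y φ + z φ, hyz, key t ht htz h0⟩
    · have e : ∀ φ : L →L[ℝ] ℝ, φ ((2 : ℝ) • (b - t) - b) = -φ ((2 : ℝ) • t - b) := by
        intro φ; simp only [map_sub, map_smul, smul_eq_mul]; ring
      refine ⟨r + (b - t), hr.add ht.compl hab, fun φ => y φ + z φ, hyz, key _ ht.compl ?_ ?_⟩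
      · simpa only [e, neg_sq] using htz
      · simpa only [e, mul_neg, Finset.sum_neg_distrib, neg_nonpos] using h0

end IsDisjointSum

/-- No component c satisfies 2c = x, since c and x - c are disjoint and x ≠ 0. The components form a
compact set, so finitely many functionals keep 2c - x away from 0 by a uniform amount δ.
Decompositions of x into sufficiently small disjoint pieces would contradict this. -/
lemma exists_not_isDisjointSum {x : L} (hx : 0 < x) (hK : IsCompact (Set.Icc 0 x)) :
    ∃ ε : ℝ, 0 < ε ∧ ¬ IsDisjointSum ε x := by
  by_contra! hcon
  have hC : IsCompact {c : L | IsComponent x c} :=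
    hK.of_isClosed_subset (isClosed_setOf_isComponent x) fun c hc => ⟨hc.nonneg, hc.le⟩
  have hne : ∀ c, IsComponent x c → ∃ φ : L →L[ℝ] ℝ, φ ((2 : ℝ) • c - x) ≠ 0 := by
    intro c hc
    refine SeparatingDual.exists_ne_zero fun e => hx.ne' ?_
    have hxc : x = c + c := by rw [← two_smul ℝ]; exact (sub_eq_zero.1 e).symm
    have : c = 0 := by simpa [IsComponent, hxc] using hc
    simp [hxc, this]
  choose! φ hφ using hne
  obtain ⟨t, ht, hcov⟩ := hC.elim_nhds_subcover (fun c => {d | φ c ((2 : ℝ) • d - x) ≠ 0})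
    (fun c hc => IsOpen.mem_nhds (isOpen_ne.preimage (by fun_prop)) (hφ c hc))
  classical
  set s := t.image φ with hs
  have hpos : ∀ c, IsComponent x c → 0 < ∑ ψ ∈ s, ψ ((2 : ℝ) • c - x) ^ 2 := by
    intro c hc
    obtain ⟨d, hd, hcd⟩ := Set.mem_iUnion₂.1 (hcov hc)
    exact Finset.sum_pos' (fun _ _ => sq_nonneg _)
      ⟨φ d, Finset.mem_image_of_mem _ hd, by have : φ d ((2 : ℝ) • c - x) ≠ 0 := hcd; positivity⟩
  have hxC : IsComponent x x := by simp [IsComponent, hx.le]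
  obtain ⟨c₀, hc₀, hmin⟩ := hC.exists_isMinOn ⟨x, hxC⟩
    (f := fun c => ∑ ψ ∈ s, ψ ((2 : ℝ) • c - x) ^ 2) (by fun_prop)
  set δ := ∑ ψ ∈ s, ψ ((2 : ℝ) • c₀ - x) ^ 2
  have hδ : 0 < δ := hpos c₀ hc₀
  set M := ∑ ψ ∈ s, ‖ψ‖
  have hM0 : 0 ≤ M := Finset.sum_nonneg fun _ _ => norm_nonneg _
  have hden : 0 < M * (M * ‖x‖) + 1 := by positivity
  have hM : ∀ ψ ∈ s, ‖ψ‖ ≤ M := fun ψ hψ =>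
    Finset.single_le_sum (f := fun ψ : L →L[ℝ] ℝ => ‖ψ‖) (fun _ _ => norm_nonneg _) hψ
  -- The size of the pieces is chosen so that the error bound, at most this size times M · (M‖x‖),
  -- stays strictly below δ.
  obtain ⟨r, hr, y, hy, hle⟩ :=
    (hcon (δ / (M * (M * ‖x‖) + 1)) (by positivity)).exists_isComponent_sum_sq_le s hM
  have h₁ : δ ≤ ∑ ψ ∈ s, ψ ((2 : ℝ) • r - x) ^ 2 := hmin hr
  have h₂ : ∑ ψ ∈ s, ψ (y ψ) ≤ M * ‖x‖ := by
    rw [Finset.sum_mul]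
    refine Finset.sum_le_sum fun ψ _ => (le_abs_self _).trans ((ψ.le_opNorm _).trans ?_)
    refine mul_le_mul_of_nonneg_left (norm_le_norm_of_abs_le_abs ?_) (norm_nonneg _)
    exact (hy ψ).trans (le_abs_self x)
  have h₃ : δ ≤ δ / (M * (M * ‖x‖) + 1) * M * (M * ‖x‖) :=
    (h₁.trans hle).trans (mul_le_mul_of_nonneg_left h₂ (by positivity))
  rw [div_mul_eq_mul_div, div_mul_eq_mul_div, le_div_iff₀ hden] at h₃
  nlinarith

/-- In a compact order interval, the band generated by `u` splits off a component. -/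
lemma exists_isComponent_of_disjoint {c u v : L} (hK : IsCompact (Set.Icc 0 c)) (hu : 0 ≤ u)
    (hv : 0 ≤ v) (huc : u ≤ c) (hvc : v ≤ c) (huv : u ⊓ v = 0) :
    ∃ a, IsComponent c a ∧ u ≤ a ∧ v ≤ c - a := by
  have hc := hu.trans huc
  set f : ℕ → L := fun n => ((n : ℝ) • u) ⊓ c with hf
  have hmono : Monotone f := fun m n hmn =>
    inf_le_inf_right _ (smul_le_smul_of_nonneg_right (by exact_mod_cast hmn) hu)
  have hf0 : ∀ n, 0 ≤ f n := fun n => le_inf (smul_nonneg n.cast_nonneg hu) hc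
  obtain ⟨a, ha, hub⟩ := IsCompact.exists_upperBound_mem_closure hK (S := Set.range f)
    (by rintro _ ⟨n, rfl⟩; exact ⟨hf0 n, inf_le_right⟩) isClosed_Icc (Set.range_nonempty f)
    hmono.directed_le.directedOn_range
  have hcl : ∀ {s : Set L}, IsClosed s → (∀ n, f n ∈ s) → a ∈ s := fun hs h =>
    hs.closure_subset_iff.2 (Set.range_subset_iff.2 h) ha
  have ha0 : 0 ≤ a := hcl isClosed_Ici hf0
  have hac : a ≤ c := hcl isClosed_Iic fun n => inf_le_right
  have hua : u ≤ a := le_trans (by simp [hf, huc]) (hub _ ⟨1, rfl⟩)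
  have hav : a ⊓ v = 0 := by
    refine hcl (isClosed_eq (f := fun z => z ⊓ v) (by fun_prop) continuous_const) fun n => ?_
    have : ((n : ℝ) • u) ⊓ v = 0 := by
      induction n with
      | zero => simp [hv]
      | succ n ih =>
        push_cast
        rw [add_smul, one_smul, inf_comm]
        exact inf_add_eq_zero hv (smul_nonneg n.cast_nonneg hu) hu (by rwa [inf_comm])
          (by rwa [inf_comm])
    exact inf_eq_zero_of_le (hf0 n) hv inf_le_left le_rfl this
  -- Doubling the n-th truncation and cutting at c stays below the 2n-th one, hence below the limit
  -- a. Subtracting a, this says a ⊓ (c - a) ≤ 0.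
  have h2 : (a + a) ⊓ c ≤ a := by
    refine hcl (s := {z : L | (z + z) ⊓ c ≤ a}) (isClosed_le (by fun_prop) continuous_const)
      fun n => ?_
    refine le_trans (inf_le_inf_right c (add_le_add inf_le_left inf_le_left)) (hub _ ⟨2 * n, ?_⟩)
    simp only [hf]
    push_cast
    rw [mul_smul, two_smul]
  have hcomp : IsComponent c a := by
    refine le_antisymm ?_ (le_inf ha0 (sub_nonneg.2 hac))
    have : a ⊓ (c - a) + a ≤ a := by rw [inf_add, sub_add_cancel]; exact h2
    simpa using this
  refine ⟨a, hcomp, hua, ?_⟩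
  have := eq_inf_add_inf_of_le_add hv ha0 hcomp.sub_nonneg hcomp (by rwa [add_sub_cancel])
  rw [inf_comm v a, hav, zero_add] at this
  exact this ▸ inf_le_right

/-- By compactness there is a minimal component c of x that is not a disjoint sum of ε-small pieces.
If c were not an atom, it would split into two proper components; by minimality both are disjoint
sums of small pieces, and then so is c. -/
lemma exists_isLatticeAtom_le {x : L} (hx : 0 < x) (hK : IsCompact (Set.Icc 0 x)) :
    ∃ a, IsLatticeAtom a ∧ a ≤ x := by
  obtain ⟨ε, hε, hxε⟩ := exists_not_isDisjointSum hx hK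
  set F : Set L := {c | IsComponent x c ∧ ¬ IsDisjointSum ε c} with hF
  have hFcl : IsClosed F := by
    refine isClosed_of_closure_subset fun c hc => ?_
    have hcx : IsComponent x c := (isClosed_setOf_isComponent x).closure_subset_iff.2
      (fun d hd => hd.1) hc
    refine ⟨hcx, fun hcε => ?_⟩
    obtain ⟨d, hd, hcd⟩ := Metric.mem_closure_iff.1 hc ε hε
    exact hd.2 (hcε.of_norm_sub_lt hcx hd.1 (by rwa [dist_comm, dist_eq_norm] at hcd))
  have hFK : IsCompact F := hK.of_isClosed_subset hFcl fun c hc => ⟨hc.1.nonneg, hc.1.le⟩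
  obtain ⟨c, hcF, hmin⟩ := IsCompact.exists_minimal_mem hFK hFcl
    ⟨x, by simp [IsComponent, hx.le], hxε⟩
  refine ⟨c, ?_, hcF.1.le⟩
  have hc0 : 0 < c := lt_of_le_of_ne hcF.1.nonneg fun e =>
    hcF.2 (e ▸ .of_norm_lt le_rfl (by simpa using hε))
  have hsmall : ∀ a, IsComponent c a → 0 < c - a → IsDisjointSum ε a := by
    intro a ha hca
    by_contra hn
    exact hca.not_ge (sub_nonpos.2 (hmin ⟨hcF.1.trans ha, hn⟩ ha.le))
  by_contra hna
  obtain ⟨u, v, hu, hv, huc, hvc, huv⟩ := exists_disjoint_of_not_isLatticeAtom hc0 hna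
  obtain ⟨a, ha, hua, hva⟩ := exists_isComponent_of_disjoint
    (hK.of_isClosed_subset isClosed_Icc (Set.Icc_subset_Icc_right hcF.1.le)) hu.le hv.le huc hvc huv
  have := IsDisjointSum.add (hsmall a ha (hv.trans_le hva))
    (hsmall (c - a) ha.compl (by rw [sub_sub_cancel]; exact hu.trans_le hua)) ha
  rw [add_sub_cancel] at this
  exact hcF.2 this

variable (L) in
/-- All order intervals of `L` are norm compact. -/
def CompactIntervals : Prop := ∀ x : L, IsCompact (Set.Icc 0 x)

lemma CompactIntervals.atomicLattice (h : CompactIntervals L) : AtomicLattice L :=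
  fun x hx => exists_isLatticeAtom_le hx (h x)

/-- The part of D below a fixed d in D lies in a compact interval, so its closure contains a lower
bound of it. By directedness this bounds all of D, so it is 0, and it is a norm limit of elements of
D. -/
lemma CompactIntervals.orderContinuousNorm (h : CompactIntervals L) : OrderContinuousNorm L := by
  intro D hne hdir hglb ε hε
  obtain ⟨d, hd⟩ := hne
  have hsub : D ∩ Set.Iic d ⊆ Set.Icc 0 d := fun z hz => ⟨hglb.1 hz.1, hz.2⟩
  obtain ⟨a, ha, hlb⟩ := IsCompact.exists_lowerBound_mem_closure (h d) hsub isClosed_Icc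
    ⟨d, hd, le_refl d⟩ (by
      rintro s ⟨hs, hsd⟩ t ⟨ht, -⟩
      obtain ⟨r, hr, hrs, hrt⟩ := hdir s hs t ht
      exact ⟨r, ⟨hr, le_trans hrs hsd⟩, hrs, hrt⟩)
  have ha0 : a = 0 := by
    refine le_antisymm (hglb.2 fun z hz => ?_) (isClosed_Icc.closure_subset_iff.2 hsub ha).1
    obtain ⟨r, hr, hrz, hrd⟩ := hdir z hz d hd
    exact (hlb r ⟨hr, hrd⟩).trans hrz
  obtain ⟨z, hz, hdist⟩ := Metric.mem_closure_iff.1 ha ε hε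
  exact ⟨z, hz.1, by simpa [ha0] using hdist⟩

/-! ### From atoms and order continuity to compact intervals. -/

variable (L) in
/-- The finite sums of nonnegative multiples of atoms. -/
def atomSums : AddSubmonoid L :=
  AddSubmonoid.closure {z | ∃ (a : L) (c : ℝ), IsLatticeAtom a ∧ 0 ≤ c ∧ z = c • a}

lemma IsLatticeAtom.exists_smul_eq {a y : L} {c : ℝ} (ha : IsLatticeAtom a) (hc : 0 ≤ c)
    (hy : 0 ≤ y) (hyc : y ≤ c • a) : ∃ t ∈ Set.Icc 0 c, y = t • a := by
  rcases hc.eq_or_lt with rfl | hc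
  · exact ⟨0, by simp, by simpa using le_antisymm (by simpa using hyc) hy⟩
  obtain ⟨t, ht⟩ := ha.2 (c⁻¹ • y) (smul_nonneg (by positivity) hy) (by
    simpa [smul_smul, hc.ne'] using smul_le_smul_of_nonneg_left hyc (inv_nonneg.2 hc.le))
  have hyt : y = (c * t) • a := by rw [mul_smul, ← ht, smul_smul, mul_inv_cancel₀ hc.ne', one_smul]
  refine ⟨c * t, ⟨?_, ?_⟩, hyt⟩
  · by_contra! hn
    have h₁ : (c * t) • a < 0 := by
      have := (smul_nonneg (neg_pos.2 hn).le ha.1.le).lt_of_ne'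
        (smul_ne_zero (neg_pos.2 hn).ne' ha.1.ne')
      rwa [neg_smul, Left.neg_pos_iff] at this
    exact (hyt ▸ hy).not_gt h₁
  · by_contra! hn
    have h₁ := (smul_nonneg (sub_pos.2 hn).le ha.1.le).lt_of_ne'
      (smul_ne_zero (sub_pos.2 hn).ne' ha.1.ne')
    rw [sub_smul, sub_pos, ← hyt] at h₁
    exact hyc.not_gt h₁

lemma atomSums_nonneg {s : L} (hs : s ∈ atomSums L) : 0 ≤ s := by
  induction hs using AddSubmonoid.closure_induction with
  | mem z hz =>
    obtain ⟨a, c, ha, hc, rfl⟩ := hz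
    exact smul_nonneg hc ha.1.le
  | zero => exact le_rfl
  | add _ _ _ _ h₁ h₂ => exact add_nonneg h₁ h₂

lemma mem_atomSums_of_le {s y : L} (hs : s ∈ atomSums L) (hy : 0 ≤ y) (hys : y ≤ s) :
    y ∈ atomSums L := by
  induction hs using AddSubmonoid.closure_induction generalizing y with
  | mem z hz =>
    obtain ⟨a, c, ha, hc, rfl⟩ := hz
    obtain ⟨t, ht, rfl⟩ := ha.exists_smul_eq hc hy hys
    exact AddSubmonoid.subset_closure ⟨a, t, ha, ht.1, rfl⟩
  | zero => rw [le_antisymm hys hy]; exact zero_mem _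
  | add a b ha hb iha ihb =>
    obtain ⟨y₁, y₂, h₁, h₁', h₂, h₂', rfl⟩ :=
      exists_add_eq_of_le_add hy (atomSums_nonneg ha) (atomSums_nonneg hb) hys
    exact add_mem (iha h₁ h₁') (ihb h₂ h₂')

/-- For an atom the interval is covered by a segment; for sums, Riesz decomposition gives [0, a + b]
⊆ [0, a] + [0, b]. -/
lemma isCompact_Icc_of_mem_atomSums {s : L} (hs : s ∈ atomSums L) : IsCompact (Set.Icc 0 s) := by
  induction hs using AddSubmonoid.closure_induction with
  | mem z hz =>
    obtain ⟨a, c, ha, hc, rfl⟩ := hz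
    refine ((isCompact_Icc (a := (0 : ℝ)) (b := c)).image (f := fun t => t • a)
      (by fun_prop)).of_isClosed_subset isClosed_Icc fun y hy => ?_
    obtain ⟨t, ht, rfl⟩ := ha.exists_smul_eq hc hy.1 hy.2
    exact ⟨t, ht, rfl⟩
  | zero => simp
  | add a b ha hb iha ihb =>
    refine ((iha.prod ihb).image (f := fun p : L × L => p.1 + p.2)
      (by fun_prop)).of_isClosed_subset isClosed_Icc fun y hy => ?_
    obtain ⟨y₁, y₂, h₁, h₁', h₂, h₂', rfl⟩ :=
      exists_add_eq_of_le_add hy.1 (atomSums_nonneg ha) (atomSums_nonneg hb) hy.2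
    exact ⟨(y₁, y₂), ⟨⟨h₁, h₁'⟩, ⟨h₂, h₂'⟩⟩, rfl⟩

lemma eq_zero_of_nsmul_le {a x : L} (ha : 0 ≤ a) (h : ∀ n : ℕ, n • a ≤ x) : a = 0 := by
  by_contra hne
  obtain ⟨n, hn⟩ := exists_nat_gt (‖x‖ / ‖a‖)
  have h₁ : ‖n • a‖ ≤ ‖x‖ := norm_le_norm_of_abs_le_abs (by
    rw [abs_of_nonneg (nsmul_nonneg ha n)]
    exact (h n).trans (le_abs_self x))
  rw [div_lt_iff₀ (norm_pos_iff.2 hne)] at hn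
  rw [← Nat.cast_smul_eq_nsmul ℝ, norm_smul, Real.norm_natCast] at h₁
  linarith

/-- Order continuity is applied to the differences x - s. They are directed because atom sums below
x are closed under suprema. -/
lemma exists_atomSums_norm_sub_lt (hA : AtomicLattice L) (hO : OrderContinuousNorm L) {x : L}
    (hx : 0 ≤ x) {ε : ℝ} (hε : 0 < ε) : ∃ s ∈ atomSums L, s ≤ x ∧ ‖x - s‖ < ε := by
  set D : Set L := (fun s => x - s) '' {s | s ∈ atomSums L ∧ s ≤ x}
  have hdir : DirectedOn (fun x y => y ≤ x) D := by
    rintro _ ⟨s, ⟨hs, hsx⟩, rfl⟩ _ ⟨t, ⟨ht, htx⟩, rfl⟩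
    have hs0 := atomSums_nonneg hs
    have ht0 := atomSums_nonneg ht
    exact ⟨x - s ⊔ t, ⟨s ⊔ t, ⟨mem_atomSums_of_le (add_mem hs ht) (hs0.trans le_sup_left)
      (sup_le (le_add_of_nonneg_right ht0) (le_add_of_nonneg_left hs0)), sup_le hsx htx⟩, rfl⟩,
      sub_le_sub_left le_sup_left _, sub_le_sub_left le_sup_right _⟩
  -- If w ⊔ 0 dominated an atom a, then na ≤ x would give a ≤ x - na, so na ≤ x for every n, against
  -- the Archimedean property.
  have hlow : ∀ w ∈ lowerBounds D, w ≤ 0 := by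
    intro w hw
    by_contra hw0
    have hpos : 0 < w ⊔ 0 := lt_of_le_of_ne le_sup_right fun e => hw0 (sup_eq_right.1 e.symm)
    obtain ⟨a, ha, haw⟩ := hA _ hpos
    have hn : ∀ n : ℕ, n • a ∈ atomSums L ∧ n • a ≤ x := by
      intro n
      induction n with
      | zero => simpa using hx
      | succ n ih =>
        have hmem : a ∈ atomSums L :=
          AddSubmonoid.subset_closure ⟨a, 1, ha, zero_le_one, (one_smul ℝ a).symm⟩
        refine ⟨AddSubmonoid.nsmul_mem _ hmem _, ?_⟩
        have h₁ : w ⊔ 0 ≤ x - n • a := sup_le (hw ⟨_, ih, rfl⟩) (sub_nonneg.2 ih.2)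
        rw [succ_nsmul, add_comm]
        exact le_sub_iff_add_le.1 (haw.trans h₁)
    exact ha.1.ne' (eq_zero_of_nsmul_le ha.1.le fun n => (hn n).2)
  obtain ⟨_, ⟨s, ⟨hs, hsx⟩, rfl⟩, hlt⟩ := hO D ⟨_, 0, ⟨zero_mem _, hx⟩, rfl⟩ hdir
    ⟨by rintro _ ⟨s, ⟨-, hsx⟩, rfl⟩; exact sub_nonneg.2 hsx, hlow⟩ ε hε
  exact ⟨s, hs, hsx, hlt⟩

/-- For an atom sum s ≤ x near x, every y in [0, x] is an element of the compact interval [0, s]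
plus one of [0, x - s], which is small. Hence [0, x] is totally bounded. -/
lemma AtomicLattice.compactIntervals [CompleteSpace L] (hA : AtomicLattice L)
    (hO : OrderContinuousNorm L) : CompactIntervals L := by
  intro x
  by_cases hx : 0 ≤ x
  swap
  · rw [Set.Icc_eq_empty hx]; exact isCompact_empty
  refine TotallyBounded.isCompact_of_isClosed (Metric.totallyBounded_iff.2 fun ε hε => ?_)
    isClosed_Icc
  obtain ⟨s, hs, hsx, hlt⟩ := exists_atomSums_norm_sub_lt hA hO hx (half_pos hε)
  obtain ⟨t, ht, hcov⟩ := Metric.totallyBounded_iff.1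
    (isCompact_Icc_of_mem_atomSums hs).totallyBounded (ε / 2) (half_pos hε)
  refine ⟨t, ht, fun y hy => ?_⟩
  obtain ⟨y₁, y₂, h₁, h₁', h₂, h₂', rfl⟩ := exists_add_eq_of_le_add hy.1 (atomSums_nonneg hs)
    (sub_nonneg.2 hsx) (hy.2.trans (add_sub_cancel s x).ge)
  obtain ⟨c, hc, hyc⟩ := Set.mem_iUnion₂.1 (hcov ⟨h₁, h₁'⟩)
  refine Set.mem_iUnion₂.2 ⟨c, hc, ?_⟩
  rw [Metric.mem_ball, dist_eq_norm] at hyc ⊢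
  have hy₂ : ‖y₂‖ ≤ ‖x - s‖ := norm_le_norm_of_abs_le_abs (by
    rwa [abs_of_nonneg h₂, abs_of_nonneg (sub_nonneg.2 hsx)])
  calc ‖y₁ + y₂ - c‖ = ‖(y₁ - c) + y₂‖ := by rw [add_sub_right_comm]
    _ ≤ ‖y₁ - c‖ + ‖y₂‖ := norm_add_le _ _
    _ < ε := by linarith

theorem compactIntervals_iff [CompleteSpace L] :
    CompactIntervals L ↔ AtomicLattice L ∧ OrderContinuousNorm L :=
  ⟨fun h => ⟨h.atomicLattice, h.orderContinuousNorm⟩, fun h => h.1.compactIntervals h.2⟩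

end Atoms

/-! ### Truncation of x + iy to a prescribed modulus. -/

section Truncation

variable {G : Type*} [AddCommGroup G] [Lattice G] [IsOrderedAddMonoid G]

/-- The truncation of `a` to the order interval `[-u, u]`. -/
def trunc (u a : G) : G := (a ⊓ u) ⊔ (-u)

lemma trunc_le {u : G} (hu : 0 ≤ u) (a : G) : trunc u a ≤ u :=
  sup_le inf_le_right (neg_le_self hu)

lemma trunc_neg {u : G} (hu : 0 ≤ u) (a : G) : trunc u (-a) = -trunc u a := by
  let _ : DistribLattice G := AddCommGroup.toDistribLattice G
  rw [trunc, trunc, neg_sup, neg_inf, neg_neg, sup_inf_right, sup_eq_left.2 (neg_le_self hu)]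

lemma sub_trunc_le {u l a : G} (hl : 0 ≤ l) (h : a ≤ u + l) : a - trunc u a ≤ l := by
  rw [sub_le_comm]
  exact (le_inf (sub_le_self _ hl) (sub_le_iff_le_add.2 h)).trans le_sup_left

lemma abs_sub_trunc_le {u l a : G} (hu : 0 ≤ u) (hl : 0 ≤ l) (h : |a| ≤ u + l) :
    |a - trunc u a| ≤ l := by
  refine abs_le'.2 ⟨sub_trunc_le hl ((le_abs_self a).trans h), ?_⟩
  have := sub_trunc_le (u := u) hl ((neg_le_abs a).trans h)
  rwa [trunc_neg hu, ← neg_sub'] at this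

lemma abs_trunc_le {u : G} (hu : 0 ≤ u) (a : G) : |trunc u a| ≤ u :=
  abs_le'.2 ⟨trunc_le hu a, trunc_neg hu a ▸ trunc_le hu (-a)⟩

variable [Module ℝ G] [IsOrderedModule ℝ G]

/-- Distributing the suprema leaves four terms. The one without -u is bounded by hypothesis; in the
others -u absorbs a summand and what remains is at most cu, su or 0. -/
lemma smul_trunc_add_smul_trunc_le_of_nonneg {u a b : G} (hu : 0 ≤ u) {c s : ℝ} (hc : 0 ≤ c)
    (hs : 0 ≤ s) (hc1 : c ≤ 1) (hs1 : s ≤ 1) (h : c • a + s • b ≤ u) :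
    c • trunc u a + s • trunc u b ≤ u := by
  have hle : ∀ t : ℝ, t ≤ 1 → t • u ≤ u := fun t ht => by
    simpa using smul_le_smul_of_nonneg_right ht hu
  have hmono : ∀ {t : ℝ} {p r : G}, 0 ≤ t → p ≤ r → t • p ≤ t • r := fun ht hpr =>
    smul_le_smul_of_nonneg_left hpr ht
  have hsup : ∀ {t : ℝ} (p r : G), 0 ≤ t → t • (p ⊔ r) ≤ t • p ⊔ t • r := by
    intro t p r ht
    rcases ht.eq_or_lt with rfl | ht'
    · simp
    have : p ⊔ r ≤ t⁻¹ • (t • p ⊔ t • r) := sup_le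
      (by simpa [smul_smul, ht'.ne'] using
        hmono (inv_nonneg.2 ht) (le_sup_left : t • p ≤ t • p ⊔ t • r))
      (by simpa [smul_smul, ht'.ne'] using
        hmono (inv_nonneg.2 ht) (le_sup_right : t • r ≤ t • p ⊔ t • r))
    simpa [smul_smul, ht'.ne'] using hmono ht this
  refine (add_le_add (hsup _ _ hc) (hsup _ _ hs)).trans ?_
  rw [sup_add, add_sup, add_sup]
  refine sup_le (sup_le ?_ ?_) (sup_le ?_ ?_)
  · exact (add_le_add (hmono hc inf_le_left) (hmono hs inf_le_left)).trans h
  · refine le_trans ?_ (hle c hc1)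
    rw [smul_neg, ← sub_eq_add_neg]
    exact (sub_le_self _ (smul_nonneg hs hu)).trans (hmono hc inf_le_right)
  · refine le_trans ?_ (hle s hs1)
    rw [smul_neg, neg_add_eq_sub]
    exact (sub_le_self _ (smul_nonneg hc hu)).trans (hmono hs inf_le_right)
  · rw [smul_neg, smul_neg, ← neg_add]
    exact (neg_nonpos.2 (add_nonneg (smul_nonneg hc hu) (smul_nonneg hs hu))).trans hu

lemma smul_trunc_add_smul_trunc_le {u a b : G} (hu : 0 ≤ u) {c s : ℝ} (hc1 : |c| ≤ 1)
    (hs1 : |s| ≤ 1) (h : c • a + s • b ≤ u) : c • trunc u a + s • trunc u b ≤ u := by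
  obtain ⟨hc, hc'⟩ := abs_le.1 hc1
  obtain ⟨hs, hs'⟩ := abs_le.1 hs1
  have e : ∀ (t : ℝ) (p : G), t • trunc u p = (-t) • trunc u (-p) := fun t p => by
    rw [trunc_neg hu, neg_smul_neg]
  have e' : ∀ (t : ℝ) (p : G), t • p = (-t) • (-p) := fun t p => (neg_smul_neg _ _).symm
  rcases le_total 0 c with h0 | h0 <;> rcases le_total 0 s with h1 | h1
  · exact smul_trunc_add_smul_trunc_le_of_nonneg hu h0 h1 hc' hs' h
  · rw [e s]; rw [e' s] at h
    exact smul_trunc_add_smul_trunc_le_of_nonneg hu h0 (by linarith) hc' (by linarith) h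
  · rw [e c]; rw [e' c] at h
    exact smul_trunc_add_smul_trunc_le_of_nonneg hu (by linarith) h1 (by linarith) hs' h
  · rw [e c, e s]; rw [e' c, e' s] at h
    exact smul_trunc_add_smul_trunc_le_of_nonneg hu (by linarith) (by linarith) (by linarith)
      (by linarith) h

/-- The real part `x cos θ + y sin θ` of `e^{-iθ}(x + iy)`. -/
def dir (θ : ℝ) (x y : G) : G := Real.cos θ • x + Real.sin θ • y

lemma smul_le_smul_abs {t r : ℝ} (p : G) (h : |t| ≤ r) : t • p ≤ r • |p| := by
  have h0 : t • p ≤ |t| • |p| := by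
    rcases le_total 0 t with ht | ht
    · rw [abs_of_nonneg ht]; exact smul_le_smul_of_nonneg_left (le_abs_self p) ht
    · rw [abs_of_nonpos ht, ← neg_smul_neg t p]
      exact smul_le_smul_of_nonneg_left (neg_le_abs p) (neg_nonneg.2 ht)
  exact h0.trans (smul_le_smul_of_nonneg_right h (abs_nonneg p))

lemma abs_smul_le (t : ℝ) (p : G) : |t • p| ≤ |t| • |p| :=
  abs_le'.2 ⟨smul_le_smul_abs p le_rfl, by
    rw [← neg_smul]; exact smul_le_smul_abs p (abs_neg t).le⟩

lemma dir_le (θ : ℝ) (x y : G) : dir θ x y ≤ |x| + |y| := by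
  simpa [dir] using add_le_add (smul_le_smul_abs x (Real.abs_cos_le_one θ))
    (smul_le_smul_abs y (Real.abs_sin_le_one θ))

lemma neg_dir (θ : ℝ) (x y : G) : -dir θ x y = dir (θ + Real.pi) x y := by
  rw [dir, dir, Real.cos_add_pi, Real.sin_add_pi, neg_smul, neg_smul, neg_add]

lemma dir_add (θ : ℝ) (x y a b : G) : dir θ (x + a) (y + b) = dir θ x y + dir θ a b := by
  simp only [dir, smul_add]; abel

lemma dir_le_dir_add {θ φ ε : ℝ} (hc : |Real.cos φ - Real.cos θ| ≤ ε)
    (hs : |Real.sin φ - Real.sin θ| ≤ ε) (x y : G) :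
    dir φ x y ≤ dir θ x y + ε • (|x| + |y|) := by
  have := add_le_add (smul_le_smul_abs x hc) (smul_le_smul_abs y hs)
  rw [dir, dir, ← sub_le_iff_le_add', smul_add]
  refine le_of_eq_of_le ?_ this
  rw [sub_smul, sub_smul]; abel

/-- Truncation of `x + iy` to a rotated square. -/
lemma exists_dir_le {u l x y : G} (hu : 0 ≤ u) (hl : 0 ≤ l) (h : ∀ φ, dir φ x y ≤ u + l) (θ : ℝ) :
    ∃ x' y' : G, |x' - x| ≤ (2 : ℝ) • l ∧ |y' - y| ≤ (2 : ℝ) • l ∧ dir θ x' y' ≤ u ∧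
      ∀ φ, dir φ x y ≤ u → dir φ x' y' ≤ u := by
  set a := dir θ x y with ha
  set b := dir (θ + Real.pi / 2) x y with hb
  have hb' : b = (-Real.sin θ) • x + Real.cos θ • y := by
    rw [hb, dir, Real.cos_add_pi_div_two, Real.sin_add_pi_div_two]
  have hcs := Real.cos_sq_add_sin_sq θ
  have hrot : ∀ φ (p r : G), Real.cos φ • (Real.cos θ • p - Real.sin θ • r) +
      Real.sin φ • (Real.sin θ • p + Real.cos θ • r) =
        Real.cos (φ - θ) • p + Real.sin (φ - θ) • r := by
    intro φ p r
    rw [Real.cos_sub, Real.sin_sub]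
    module
  have hx : x = Real.cos θ • a - Real.sin θ • b := by
    have : Real.cos θ • a - Real.sin θ • b = (Real.cos θ ^ 2 + Real.sin θ ^ 2) • x := by
      rw [hb', ha, dir]; module
    rw [this, hcs, one_smul]
  have hy : y = Real.sin θ • a + Real.cos θ • b := by
    have : Real.sin θ • a + Real.cos θ • b = (Real.cos θ ^ 2 + Real.sin θ ^ 2) • y := by
      rw [hb', ha, dir]; module
    rw [this, hcs, one_smul]
  have habs : ∀ φ, |dir φ x y| ≤ u + l := fun φ => abs_le'.2 ⟨h φ, neg_dir φ x y ▸ h _⟩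
  have hA : |trunc u a - a| ≤ l := by rw [abs_sub_comm]; exact abs_sub_trunc_le hu hl (habs θ)
  have hB : |trunc u b - b| ≤ l := by rw [abs_sub_comm]; exact abs_sub_trunc_le hu hl (habs _)
  have hbound : ∀ {c s : ℝ} {p r : G}, |c| ≤ 1 → |s| ≤ 1 → |p| ≤ l → |r| ≤ l →
      |c • p + s • r| ≤ (2 : ℝ) • l := by
    intro c s p r hc hs hp hr
    have aux : ∀ {t : ℝ} {v : G}, |t| ≤ 1 → |v| ≤ l → |t • v| ≤ l := by
      intro t v ht hv
      refine (abs_smul_le t v).trans ?_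
      refine (smul_le_smul_of_nonneg_right ht (abs_nonneg v)).trans ?_
      rwa [one_smul]
    rw [two_smul]
    exact (abs_add_le _ _).trans (add_le_add (aux hc hp) (aux hs hr))
  -- The coordinates a, b in the frame rotated by θ are truncated and rotated back. In this frame a
  -- constraint in direction φ has coefficients cos(φ - θ), sin(φ - θ), so constraints already
  -- satisfied survive.
  refine ⟨Real.cos θ • trunc u a - Real.sin θ • trunc u b,
    Real.sin θ • trunc u a + Real.cos θ • trunc u b, ?_, ?_, ?_, ?_⟩
  · have : Real.cos θ • trunc u a - Real.sin θ • trunc u b - x =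
        Real.cos θ • (trunc u a - a) + (-Real.sin θ) • (trunc u b - b) := by
      calc _ = Real.cos θ • trunc u a - Real.sin θ • trunc u b -
            (Real.cos θ • a - Real.sin θ • b) := by rw [← hx]
        _ = _ := by module
    rw [this]
    exact hbound (Real.abs_cos_le_one θ) (by simpa using Real.abs_sin_le_one θ) hA hB
  · have : Real.sin θ • trunc u a + Real.cos θ • trunc u b - y =
        Real.sin θ • (trunc u a - a) + Real.cos θ • (trunc u b - b) := by
      calc _ = Real.sin θ • trunc u a + Real.cos θ • trunc u b -
            (Real.sin θ • a + Real.cos θ • b) := by rw [← hy]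
        _ = _ := by module
    rw [this]
    exact hbound (Real.abs_sin_le_one θ) (Real.abs_cos_le_one θ) hA hB
  · rw [dir, hrot, sub_self, Real.cos_zero, Real.sin_zero, one_smul, zero_smul, add_zero]
    exact trunc_le hu a
  · intro φ hφ
    rw [dir, hrot]
    refine smul_trunc_add_smul_trunc_le hu (Real.abs_cos_le_one _) (Real.abs_sin_le_one _) ?_
    rwa [dir, hx, hy, hrot] at hφ

/-- Directions are imposed one at a time; `exists_dir_le` enforces a new one without losing the
earlier ones, at the cost of a larger multiple of l. -/
lemma exists_forall_mem_dir_le {u l x y : G} (hu : 0 ≤ u) (hl : 0 ≤ l)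
    (h : ∀ φ, dir φ x y ≤ u + l) (S : Finset ℝ) :
    ∃ (N : ℝ) (x' y' : G), 0 ≤ N ∧ |x' - x| ≤ N • l ∧ |y' - y| ≤ N • l ∧
      ∀ φ ∈ S, dir φ x' y' ≤ u := by
  classical
  induction S using Finset.induction_on with
  | empty => exact ⟨0, x, y, le_rfl, by simp, by simp, by simp⟩
  | insert θ S _ ih =>
    obtain ⟨N, x', y', hN, hx, hy, hS⟩ := ih
    -- One l comes from the hypothesis and N • l from the change of each coordinate.
    have hbd : ∀ φ, dir φ x' y' ≤ u + (1 + 2 * N) • l := by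
      intro φ
      have e := dir_add φ x y (x' - x) (y' - y)
      rw [add_sub_cancel, add_sub_cancel] at e
      rw [e]
      refine (add_le_add (h φ) ((dir_le φ _ _).trans (add_le_add hx hy))).trans (le_of_eq ?_)
      module
    obtain ⟨x'', y'', hx', hy', hθ, hφ⟩ := exists_dir_le hu (smul_nonneg (by positivity) hl) hbd θ
    have htri : ∀ {p q r : G}, |q - p| ≤ N • l → |r - q| ≤ (2 : ℝ) • (1 + 2 * N) • l →
        |r - p| ≤ (N + 2 * (1 + 2 * N)) • l := by
      intro p q r h₁ h₂
      rw [← sub_add_sub_cancel' q p r, add_smul, mul_smul]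
      exact (abs_add_le _ _).trans (add_le_add h₁ h₂)
    refine ⟨N + 2 * (1 + 2 * N), x'', y'', by positivity, htri hx hx', htri hy hy', ?_⟩
    intro φ hφS
    rcases Finset.mem_insert.1 hφS with rfl | hφS
    · exact hθ
    · exact hφ φ (hS φ hφS)

lemma exists_finset_angles {ε : ℝ} (hε : 0 < ε) : ∃ S : Finset ℝ, ∀ φ : ℝ, ∃ θ ∈ S,
    |Real.cos φ - Real.cos θ| ≤ ε ∧ |Real.sin φ - Real.sin θ| ≤ ε := by
  classical
  have hb : TotallyBounded (Set.range fun φ : ℝ => (Real.cos φ, Real.sin φ)) := by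
    refine TotallyBounded.subset ?_ (isCompact_closedBall (0 : ℝ × ℝ) 1).totallyBounded
    rintro _ ⟨φ, rfl⟩
    simp [Prod.norm_def, Real.abs_cos_le_one, Real.abs_sin_le_one]
  obtain ⟨t, ht, htfin, hcov⟩ := totallyBounded_iff_subset.1 hb _ (Metric.dist_mem_uniformity hε)
  have ht' : ∀ p ∈ t, ∃ φ : ℝ, (Real.cos φ, Real.sin φ) = p := fun p hp => ht hp
  choose! g hg using ht'
  refine ⟨htfin.toFinset.image g, fun φ => ?_⟩
  obtain ⟨p, hp, hpφ⟩ := Set.mem_iUnion₂.1 (hcov ⟨φ, rfl⟩)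
  refine ⟨g p, Finset.mem_image_of_mem _ (htfin.mem_toFinset.2 hp), ?_⟩
  rw [← hg p hp] at hpφ
  have hpφ : dist (Real.cos φ, Real.sin φ) (Real.cos (g p), Real.sin (g p)) < ε := hpφ
  rw [Prod.dist_eq, max_lt_iff, Real.dist_eq, Real.dist_eq] at hpφ
  exact ⟨hpφ.1.le, hpφ.2.le⟩

/-- If `|x + iy| ≤ u + l`, then `x + iy` can be changed by an element of the ideal generated by `l`
so that its modulus becomes at most `(1 + ε)u`. -/
lemma exists_forall_dir_le {u l x y : G} (hu : 0 ≤ u) (hl : 0 ≤ l)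
    (h : ∀ φ, dir φ x y ≤ u + l) {ε : ℝ} (hε : 0 < ε) :
    ∃ (N : ℝ) (x' y' : G), |x' - x| ≤ N • l ∧ |y' - y| ≤ N • l ∧
      ∀ φ, dir φ x' y' ≤ (1 + ε) • u := by
  classical
  obtain ⟨S, hS⟩ := exists_finset_angles (half_pos hε)
  -- The four extra angles give |x'| ≤ u and |y'| ≤ u, so moving from any angle to a nearby one in S
  -- costs at most (ε/2)(u + u).
  obtain ⟨N, x', y', -, hx, hy, hdir⟩ := exists_forall_mem_dir_le hu hl h
    (S ∪ {0, Real.pi, Real.pi / 2, Real.pi / 2 + Real.pi})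
  refine ⟨N, x', y', hx, hy, fun φ => ?_⟩
  have hx' : |x'| ≤ u := abs_le'.2 ⟨by simpa [dir] using hdir 0 (by simp),
    by simpa [dir] using hdir Real.pi (by simp)⟩
  have hy' : |y'| ≤ u := abs_le'.2 ⟨by simpa [dir] using hdir (Real.pi / 2) (by simp), by
    have := hdir (Real.pi / 2 + Real.pi) (by simp)
    rw [← neg_dir] at this
    simpa [dir] using this⟩
  obtain ⟨θ, hθ, hc, hs⟩ := hS φ
  refine (dir_le_dir_add hc hs x' y').trans ?_
  refine (add_le_add (hdir θ (Finset.mem_union_left _ hθ))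
    (smul_le_smul_of_nonneg_left (add_le_add hx' hy') (half_pos hε).le)).trans (le_of_eq ?_)
  module

end Truncation

/-! ### The quotient of a normed lattice by a lattice ideal. -/

section QuotientLattice

variable {B : Type*} [NormedAddCommGroup B] [NormedSpace ℝ B] [Lattice B] [IsOrderedAddMonoid B]
  [IsOrderedModule ℝ B] [HasSolidNorm B]

/-- The subspace `I` is a lattice ideal. -/
class IsLatticeIdeal (I : Submodule ℝ B) : Prop where
  mem_of_abs_le_abs : ∀ {x y : B}, |x| ≤ |y| → y ∈ I → x ∈ I

variable (I : Submodule ℝ B) [hI : IsLatticeIdeal I]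

namespace IsLatticeIdeal

variable {I}

lemma mem_of_abs_le {x y : B} (h : |x| ≤ y) (hy : y ∈ I) : x ∈ I :=
  hI.mem_of_abs_le_abs (h.trans (le_abs_self y)) hy

lemma abs_mem {x : B} (hx : x ∈ I) : |x| ∈ I :=
  hI.mem_of_abs_le_abs (abs_abs x).le hx

end IsLatticeIdeal

open IsLatticeIdeal

instance : LE (B ⧸ I) where
  le a b := ∃ x : B, 0 ≤ x ∧ I.mkQ x = b - a

variable {I} in
lemma mkQ_le_mkQ_iff {x y : B} : I.mkQ x ≤ I.mkQ y ↔ ∃ i ∈ I, x ≤ y + i := by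
  constructor
  · rintro ⟨z, hz, h⟩
    rw [← map_sub, ← sub_eq_zero, ← map_sub, ← LinearMap.mem_ker, Submodule.ker_mkQ] at h
    exact ⟨_, h, by rw [← sub_nonneg]; convert hz using 1; abel⟩
  · rintro ⟨i, hi, h⟩
    refine ⟨y + i - x, sub_nonneg.2 h, ?_⟩
    have : I.mkQ i = 0 := by rwa [← LinearMap.mem_ker, Submodule.ker_mkQ]
    rw [map_sub, map_add, this, add_zero]

variable {I} in
lemma mkQ_mono {x y : B} (h : x ≤ y) : I.mkQ x ≤ I.mkQ y :=
  mkQ_le_mkQ_iff.2 ⟨0, zero_mem _, by simpa using h⟩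

instance : PartialOrder (B ⧸ I) where
  le_refl a := ⟨0, le_rfl, by simp⟩
  le_trans := by
    rintro a b c ⟨x, hx, h⟩ ⟨y, hy, h'⟩
    exact ⟨x + y, add_nonneg hx hy, by rw [map_add, h, h']; abel⟩
  le_antisymm a b hab hba := by
    obtain ⟨x, rfl⟩ := I.mkQ_surjective a
    obtain ⟨y, rfl⟩ := I.mkQ_surjective b
    obtain ⟨i, hi, h⟩ := mkQ_le_mkQ_iff.1 hab
    obtain ⟨k, hk, h'⟩ := mkQ_le_mkQ_iff.1 hba
    rw [← sub_eq_zero, ← map_sub, ← LinearMap.mem_ker, Submodule.ker_mkQ]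
    refine mem_of_abs_le (abs_le'.2 ⟨?_, ?_⟩) (add_mem (abs_mem hi) (abs_mem hk))
    · rw [sub_le_iff_le_add']
      exact h.trans (add_le_add_right ((le_abs_self i).trans
        (le_add_of_nonneg_right (abs_nonneg k))) y)
    · rw [neg_sub, sub_le_iff_le_add']
      exact h'.trans (add_le_add_right ((le_abs_self k).trans
        (le_add_of_nonneg_left (abs_nonneg i))) x)

instance : IsOrderedAddMonoid (B ⧸ I) where
  add_le_add_left := by
    rintro a b ⟨x, hx, h⟩ c
    exact ⟨x, hx, by rw [h]; abel⟩

instance : IsOrderedModule ℝ (B ⧸ I) := .of_smul_nonneg fun t ht a ha => by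
  obtain ⟨x, hx, h⟩ := ha
  refine ⟨t • x, smul_nonneg ht hx, ?_⟩
  rw [map_smul, h, sub_zero, sub_zero]

variable {I} in
lemma isLUB_mkQ_sup (x y : B) : IsLUB {I.mkQ x, I.mkQ y} (I.mkQ (x ⊔ y)) := by
  refine ⟨?_, fun c hc => ?_⟩
  · rintro _ (rfl | rfl)
    · exact mkQ_mono le_sup_left
    · exact mkQ_mono le_sup_right
  · obtain ⟨z, rfl⟩ := I.mkQ_surjective c
    obtain ⟨i, hi, h⟩ := mkQ_le_mkQ_iff.1 (hc (Set.mem_insert _ _))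
    obtain ⟨k, hk, h'⟩ := mkQ_le_mkQ_iff.1 (hc (Set.mem_insert_of_mem _ rfl))
    refine mkQ_le_mkQ_iff.2 ⟨|i| + |k|, add_mem (abs_mem hi) (abs_mem hk), sup_le ?_ ?_⟩
    · exact h.trans (add_le_add_right ((le_abs_self i).trans
        (le_add_of_nonneg_right (abs_nonneg k))) z)
    · exact h'.trans (add_le_add_right ((le_abs_self k).trans
        (le_add_of_nonneg_left (abs_nonneg i))) z)

variable {I} in
lemma exists_isLUB_pair (a b : B ⧸ I) : ∃ c, IsLUB {a, b} c := by
  obtain ⟨x, rfl⟩ := I.mkQ_surjective a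
  obtain ⟨y, rfl⟩ := I.mkQ_surjective b
  exact ⟨_, isLUB_mkQ_sup x y⟩

instance : Lattice (B ⧸ I) where
  sup a b := (exists_isLUB_pair a b).choose
  le_sup_left a b := (exists_isLUB_pair a b).choose_spec.1 (Set.mem_insert _ _)
  le_sup_right a b := (exists_isLUB_pair a b).choose_spec.1 (Set.mem_insert_of_mem _ rfl)
  sup_le a b c h h' :=
    (exists_isLUB_pair a b).choose_spec.2 (by rintro _ (rfl | rfl) <;> assumption)
  inf a b := -(exists_isLUB_pair (-a) (-b)).choose
  inf_le_left a b :=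
    neg_le.1 ((exists_isLUB_pair (-a) (-b)).choose_spec.1 (Set.mem_insert _ _))
  inf_le_right a b :=
    neg_le.1 ((exists_isLUB_pair (-a) (-b)).choose_spec.1 (Set.mem_insert_of_mem _ rfl))
  le_inf a b c h h' := le_neg.1 ((exists_isLUB_pair (-b) (-c)).choose_spec.2
    (by rintro _ (rfl | rfl) <;> exact neg_le_neg (by assumption)))

variable {I} in
lemma mkQ_sup (x y : B) : I.mkQ (x ⊔ y) = I.mkQ x ⊔ I.mkQ y :=
  (isLUB_mkQ_sup x y).unique isLUB_pair

variable {I} in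
lemma mkQ_abs (x : B) : I.mkQ |x| = |I.mkQ x| := by
  rw [abs, abs, mkQ_sup, map_neg]

/-- Take a nearly optimal representative y of b. Since |x| ≤ |y| + i with i in I, truncating x to
[-|y|, |y|] changes it only within I and gives a representative of norm at most ‖y‖. -/
instance [IsClosed (I : Set B)] : HasSolidNorm (B ⧸ I) where
  solid := by
    intro a b hab
    refine le_of_forall_pos_le_add fun ε hε => ?_
    obtain ⟨x, rfl⟩ := I.mkQ_surjective a
    obtain ⟨y, rfl, hy⟩ := Submodule.Quotient.norm_mk_lt b hε
    have hab : I.mkQ |x| ≤ I.mkQ |y| := by rw [mkQ_abs, mkQ_abs]; exact hab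
    obtain ⟨i, hi, h⟩ := mkQ_le_mkQ_iff.1 hab
    have hx : I.mkQ x = I.mkQ (trunc |y| x) := by
      rw [← sub_eq_zero, ← map_sub, ← LinearMap.mem_ker, Submodule.ker_mkQ]
      exact mem_of_abs_le (abs_sub_trunc_le (abs_nonneg y) (abs_nonneg i)
        (h.trans (add_le_add_right (le_abs_self i) _))) (abs_mem hi)
    rw [hx]
    exact (Submodule.Quotient.norm_mk_le I _).trans ((norm_le_norm_of_abs_le_abs
      (abs_trunc_le (abs_nonneg y) x)).trans hy.le)

end QuotientLattice

/-! ### Independence of the universe of the real part. -/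

section Transport

lemma IsComplexification.norm_eq_norm {L : Type*} [NormedAddCommGroup L] [NormedSpace ℝ L]
    [Lattice L] [IsOrderedAddMonoid L] [IsOrderedModule ℝ L] [HasSolidNorm L] {Z : Type*}
    [NormedAddCommGroup Z] [NormedSpace ℂ Z] {j : L →ₗ[ℝ] Z} (hj : IsComplexification j) (x : L) :
    ‖j x‖ = ‖x‖ := by
  obtain ⟨m, hm, h⟩ := hj.norm_eq x 0
  have : m = |x| := by
    refine hm.unique ⟨?_, fun u hu => abs_le'.2 ⟨?_, ?_⟩⟩
    · rintro _ ⟨θ, rfl⟩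
      simpa using smul_le_smul_abs x (Real.abs_cos_le_one θ)
    · simpa using hu ⟨0, rfl⟩
    · simpa using hu ⟨Real.pi, rfl⟩
  rwa [map_zero, smul_zero, add_zero, this, norm_abs_eq_norm] at h

/-- A complexification of a Banach lattice in any universe is a complex Banach lattice. -/
theorem IsComplexification.isComplexBanachLattice {L : Type*} [NormedAddCommGroup L]
    [NormedSpace ℝ L] [Lattice L] [IsOrderedAddMonoid L] [IsOrderedModule ℝ L] [HasSolidNorm L]
    [CompleteSpace L] {Z : Type u} [NormedAddCommGroup Z] [NormedSpace ℂ Z] {j : L →ₗ[ℝ] Z}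
    (hj : IsComplexification j) : IsComplexBanachLattice (j '' {x : L | 0 ≤ x}) := by
  have hinj : Function.Injective j := (injective_iff_map_eq_zero j).2 fun x hx => by
    rw [← norm_eq_zero, ← hj.norm_eq_norm, hx, norm_zero]
  -- The range of j lives in the universe of Z, as the definition requires; the lattice structure of
  -- L is carried over to it.
  let R := LinearMap.range j
  let e : R ≃ₗ[ℝ] L := (LinearEquiv.ofInjective j hinj).symm
  have hje : ∀ r : R, j (e r) = r := fun r =>
    congrArg Subtype.val ((LinearEquiv.ofInjective j hinj).apply_symm_apply r)
  have hnorm : ∀ r : R, ‖e r‖ = ‖r‖ := fun r => by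
    rw [← hj.norm_eq_norm, hje]; rfl
  let lat : Lattice R :=
    { le := fun a b => e a ≤ e b
      le_refl := fun a => le_refl (e a)
      le_trans := fun a b c h h' => le_trans (α := L) h h'
      le_antisymm := fun a b h h' => e.injective (le_antisymm h h')
      sup := fun a b => e.symm (e a ⊔ e b)
      inf := fun a b => e.symm (e a ⊓ e b)
      le_sup_left := fun a b => by
        rw [e.apply_symm_apply]; exact le_sup_left
      le_sup_right := fun a b => by
        rw [e.apply_symm_apply]; exact le_sup_right
      sup_le := fun a b c h h' => by
        rw [e.apply_symm_apply]; exact sup_le h h'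
      inf_le_left := fun a b => by
        rw [e.apply_symm_apply]; exact inf_le_left
      inf_le_right := fun a b => by
        rw [e.apply_symm_apply]; exact inf_le_right
      le_inf := fun a b c h h' => by
        rw [e.apply_symm_apply]; exact le_inf h h' }
  have hle : ∀ a b : R, a ≤ b ↔ e a ≤ e b := fun a b => Iff.rfl
  have hsup : ∀ a b : R, e (a ⊔ b) = e a ⊔ e b := fun a b => e.apply_symm_apply _
  have habs : ∀ a : R, e |a| = |e a| := fun a => by rw [abs, hsup, map_neg]; rfl
  have i₁ : IsOrderedAddMonoid R :=
    { add_le_add_left := fun a b h c => by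
        rw [hle, map_add, map_add]; exact add_le_add_left ((hle a b).1 h) _ }
  have i₂ : IsOrderedModule ℝ R := .of_smul_nonneg fun t ht a ha => by
    rw [hle, map_zero] at ha ⊢
    rw [map_smul]; exact smul_nonneg ht ha
  have i₃ : HasSolidNorm R := ⟨fun a b h => by
    rw [hle, habs, habs] at h
    rw [← hnorm, ← hnorm]
    exact norm_le_norm_of_abs_le_abs h⟩
  have i₄ : CompleteSpace R :=
    (completeSpace_congr (e := e.toEquiv)
      (AddMonoidHomClass.isometry_of_norm e hnorm).isUniformEmbedding).2 inferInstance
  refine ⟨R, inferInstance, inferInstance, lat, i₁, i₂, i₃, i₄, R.subtype, ⟨fun z => ?_, ?_⟩, ?_⟩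
  · obtain ⟨p, hp, huniq⟩ := hj.existsUnique_decomp z
    refine ⟨(e.symm p.1, e.symm p.2), ?_, fun q hq => ?_⟩
    · simpa only [Submodule.subtype_apply, ← hje, e.apply_symm_apply] using hp
    · have := huniq (e q.1, e q.2) (by dsimp only; rw [hje, hje]; exact hq)
      rw [← this]
      simp
  · intro x y
    obtain ⟨m, hm, h⟩ := hj.norm_eq (e x) (e y)
    refine ⟨e.symm m, ⟨?_, fun u hu => ?_⟩, ?_⟩
    · rintro _ ⟨θ, rfl⟩
      rw [hle, e.apply_symm_apply]
      simpa only [map_add, map_smul] using hm.1 ⟨θ, rfl⟩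
    · rw [hle, e.apply_symm_apply]
      refine hm.2 ?_
      rintro _ ⟨θ, rfl⟩
      have := (hle _ _).1 (hu ⟨θ, rfl⟩)
      simpa only [map_add, map_smul] using this
    · rw [← hnorm, e.apply_symm_apply, ← h, hje, hje]; rfl
  · ext z
    constructor
    · rintro ⟨x, hx, rfl⟩
      refine ⟨e.symm x, ?_, ?_⟩
      · change 0 ≤ e.symm x
        rw [hle, e.apply_symm_apply, map_zero]; exact hx
      · rw [Submodule.subtype_apply, ← hje, e.apply_symm_apply]
    · rintro ⟨r, hr, rfl⟩
      have hr : (0 : R) ≤ r := hr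
      rw [hle, map_zero] at hr
      exact ⟨e r, hr, hje r⟩

end Transport

/-! ### Moduli and norms in the complexified quotient. -/

section QuotientComplexification

variable {B : Type*} [NormedAddCommGroup B] [NormedSpace ℝ B] [Lattice B] [IsOrderedAddMonoid B]
  [IsOrderedModule ℝ B] [HasSolidNorm B]

/-- `m` is the modulus of `x + iy`. -/
def IsModulusPair (x y m : B) : Prop := IsLUB (Set.range fun θ : ℝ => dir θ x y) m

namespace IsModulusPair

variable {x y m : B}

lemma dir_le (h : IsModulusPair x y m) (θ : ℝ) : dir θ x y ≤ m := h.1 ⟨θ, rfl⟩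

lemma le_of_forall (h : IsModulusPair x y m) {u : B} (hu : ∀ θ, dir θ x y ≤ u) : m ≤ u :=
  h.2 (by rintro _ ⟨θ, rfl⟩; exact hu θ)

lemma abs_left_le (h : IsModulusPair x y m) : |x| ≤ m :=
  abs_le'.2 ⟨by simpa [dir] using h.dir_le 0, by simpa [dir] using h.dir_le Real.pi⟩

lemma abs_right_le (h : IsModulusPair x y m) : |y| ≤ m :=
  abs_le'.2 ⟨by simpa [dir] using h.dir_le (Real.pi / 2), by
    have := h.dir_le (Real.pi / 2 + Real.pi)
    rw [← neg_dir] at this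
    simpa [dir] using this⟩

lemma nonneg (h : IsModulusPair x y m) : 0 ≤ m := (abs_nonneg x).trans h.abs_left_le

lemma norm_le {u : B} (h : IsModulusPair x y m) (hu : ∀ θ, dir θ x y ≤ u) : ‖m‖ ≤ ‖u‖ :=
  norm_le_norm_of_abs_le_abs (by
    rw [abs_of_nonneg h.nonneg]; exact (h.le_of_forall hu).trans (le_abs_self u))

end IsModulusPair

variable (I : Submodule ℝ B) [IsLatticeIdeal I] [IsClosed (I : Set B)]

open IsLatticeIdeal

variable {I} in
lemma mkQ_dir (θ : ℝ) (x y : B) : I.mkQ (dir θ x y) = dir θ (I.mkQ x) (I.mkQ y) := by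
  simp only [dir, map_add, map_smul]

variable {I} in
lemma mkQ_eq_of_abs_sub_le {x x' l : B} (hl : l ∈ I) (h : |x' - x| ≤ l) : I.mkQ x' = I.mkQ x := by
  rw [← sub_eq_zero, ← map_sub, ← LinearMap.mem_ker, Submodule.ker_mkQ]
  exact mem_of_abs_le h hl

variable {I} in
-- A supremum over infinitely many angles need not pass to the quotient. A finite net of angles
-- needs only finitely many corrections from I, up to an error (|x| + |y|)/(n + 1), which disappears
-- in the limit because the cone of the quotient is closed.
lemma IsModulusPair.mkQ {x y m : B} (h : IsModulusPair x y m) :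
    IsModulusPair (I.mkQ x) (I.mkQ y) (I.mkQ m) := by
  classical
  refine ⟨?_, fun c hc => ?_⟩
  · rintro _ ⟨θ, rfl⟩
    dsimp only
    rw [← mkQ_dir]
    exact mkQ_mono (h.dir_le θ)
  obtain ⟨u, rfl⟩ := I.mkQ_surjective c
  have key : ∀ n : ℕ, I.mkQ m ≤ I.mkQ u + (1 / ((n : ℝ) + 1)) • I.mkQ (|x| + |y|) := by
    intro n
    obtain ⟨S, hS⟩ := exists_finset_angles (ε := 1 / ((n : ℝ) + 1)) (by positivity)
    have : ∀ θ : ℝ, ∃ i ∈ I, dir θ x y ≤ u + i := fun θ =>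
      mkQ_le_mkQ_iff.1 (by rw [mkQ_dir]; exact hc ⟨θ, rfl⟩)
    choose i hi hui using this
    have hsum : ∑ θ ∈ S, |i θ| ∈ I := sum_mem fun θ _ => abs_mem (hi θ)
    have hle : m ≤ u + (1 / ((n : ℝ) + 1)) • (|x| + |y|) + ∑ θ ∈ S, |i θ| := by
      refine h.le_of_forall fun φ => ?_
      obtain ⟨θ, hθ, hcos, hsin⟩ := hS φ
      refine (dir_le_dir_add hcos hsin x y).trans ?_
      rw [add_right_comm]
      refine add_le_add_left ((hui θ).trans (add_le_add_right ((le_abs_self _).trans ?_) u)) _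
      exact Finset.single_le_sum (f := fun θ => |i θ|) (fun _ _ => abs_nonneg _) hθ
    have := mkQ_le_mkQ_iff.2 ⟨_, hsum, hle⟩
    rwa [map_add, map_smul] at this
  have hlim : Tendsto (fun n : ℕ => I.mkQ u + (1 / ((n : ℝ) + 1)) • I.mkQ (|x| + |y|)) atTop
      (nhds (I.mkQ u + (0 : ℝ) • I.mkQ (|x| + |y|))) :=
    tendsto_const_nhds.add (tendsto_one_div_add_atTop_nhds_zero_nat.smul_const _)
  rw [zero_smul, add_zero] at hlim
  exact ge_of_tendsto' hlim key

/-- The quotient of the complexification of a Banach lattice by the complexification of a closed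
ideal is a complex Banach lattice. -/
theorem isComplexBanachLattice_image_of_ideal [CompleteSpace B] {Z : Type u}
    [NormedAddCommGroup Z] [NormedSpace ℂ Z] (hM : ∀ x y : B, ∃ m, IsModulusPair x y m)
    (q : B →ₗ[ℝ] Z) (hsurj : ∀ z, ∃ x y, z = q x + Complex.I • q y) (hI : ∀ x ∈ I, q x = 0)
    (hinj : ∀ x y, q x + Complex.I • q y = 0 → x ∈ I ∧ y ∈ I)
    (hle : ∀ x y m, IsModulusPair x y m → ‖q x + Complex.I • q y‖ ≤ ‖m‖)
    (hge : ∀ x y r, ‖q x + Complex.I • q y‖ < r →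
      ∃ a ∈ I, ∃ b ∈ I, ∃ m, IsModulusPair (x + a) (y + b) m ∧ ‖m‖ ≤ r) :
    IsComplexBanachLattice (q '' {x : B | 0 ≤ x}) := by
  let j : B ⧸ I →ₗ[ℝ] Z := I.liftQ q fun x hx => hI x hx
  have hj : ∀ x, j (I.mkQ x) = q x := fun x => Submodule.liftQ_apply _ _ _
  have himage : q '' {x : B | 0 ≤ x} = j '' {x : B ⧸ I | 0 ≤ x} := by
    ext z
    constructor
    · rintro ⟨x, hx, rfl⟩
      exact ⟨I.mkQ x, by simpa using mkQ_mono (I := I) hx, hj x⟩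
    · rintro ⟨_, ⟨x, hx, h⟩, rfl⟩
      exact ⟨x, hx, by rw [← hj, h, sub_zero]⟩
  rw [himage]
  refine IsComplexification.isComplexBanachLattice ⟨fun z => ?_, fun a b => ?_⟩
  · obtain ⟨x, y, rfl⟩ := hsurj z
    refine ⟨(I.mkQ x, I.mkQ y), by simp only [hj], ?_⟩
    rintro ⟨a, b⟩ hab
    obtain ⟨x', rfl⟩ := I.mkQ_surjective a
    obtain ⟨y', rfl⟩ := I.mkQ_surjective b
    simp only [hj] at hab
    obtain ⟨h₁, h₂⟩ := hinj (x' - x) (y' - y) (by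
      rw [map_sub, map_sub, smul_sub, sub_add_sub_comm, ← hab, sub_self])
    rw [← Submodule.ker_mkQ I, LinearMap.mem_ker, map_sub, sub_eq_zero] at h₁ h₂
    rw [h₁, h₂]
  · obtain ⟨x, rfl⟩ := I.mkQ_surjective a
    obtain ⟨y, rfl⟩ := I.mkQ_surjective b
    obtain ⟨m, hm⟩ := hM x y
    refine ⟨I.mkQ m, hm.mkQ, ?_⟩
    rw [hj, hj]
    refine le_antisymm (le_of_forall_pos_le_add fun δ hδ => ?_)
      (le_of_forall_pos_le_add fun δ hδ => ?_)
    -- For a nearly optimal representative w of the class of m, the modulus of x + iy is at most |w|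
    -- + |w - m| with |w - m| in I. The truncation lemma then gives a representative of modulus at
    -- most (1 + ε)|w|.
    · obtain ⟨w, hw, hwlt⟩ := Submodule.Quotient.norm_mk_lt (I.mkQ m) hδ
      have hl : w - m ∈ I := by
        rw [← Submodule.ker_mkQ I, LinearMap.mem_ker, map_sub, sub_eq_zero]; exact hw
      have hdir : ∀ φ, dir φ x y ≤ |w| + |w - m| := fun φ => by
        refine (hm.dir_le φ).trans ?_
        rw [abs_sub_comm]
        exact (sub_le_iff_le_add'.1 (le_abs_self (m - w))).trans
          (add_le_add_left (le_abs_self w) _)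
      refine le_trans ?_ hwlt.le
      have hε : ∀ ε > 0, ‖q x + Complex.I • q y‖ ≤ (1 + ε) * ‖w‖ := by
        intro ε hε
        obtain ⟨N, x', y', hx, hy, hd⟩ :=
          exists_forall_dir_le (abs_nonneg w) (abs_nonneg (w - m)) hdir hε
        have hN := I.smul_mem N (abs_mem hl)
        obtain ⟨m', hm'⟩ := hM x' y'
        rw [← hj x, ← hj y, ← mkQ_eq_of_abs_sub_le hN hx, ← mkQ_eq_of_abs_sub_le hN hy, hj, hj]
        refine (hle _ _ _ hm').trans ((hm'.norm_le hd).trans ?_)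
        rw [norm_smul, norm_abs_eq_norm, Real.norm_of_nonneg (by positivity)]
      refine le_of_forall_pos_le_add fun η hη => ?_
      refine (hε (η / (‖w‖ + 1)) (by positivity)).trans ?_
      rw [add_mul, one_mul, div_mul_eq_mul_div]
      refine add_le_add_right ((div_le_iff₀ (by positivity)).2 ?_) _
      nlinarith [norm_nonneg w]
    -- The modulus m' of the corrected pair is, in the quotient, an upper bound of the same
    -- directions, so its class dominates that of m.
    · obtain ⟨a, ha, b, hb, m', hm', hr⟩ := hge x y _ (lt_add_of_pos_right _ hδ)
      refine le_trans ?_ hr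
      refine le_trans ?_ (Submodule.Quotient.norm_mk_le (S := I) m')
      have hx : I.mkQ (x + a) = I.mkQ x := by
        rw [map_add, (LinearMap.mem_ker.1 ((Submodule.ker_mkQ I).symm ▸ ha) : I.mkQ a = 0),
          add_zero]
      have hy : I.mkQ (y + b) = I.mkQ y := by
        rw [map_add, (LinearMap.mem_ker.1 ((Submodule.ker_mkQ I).symm ▸ hb) : I.mkQ b = 0),
          add_zero]
      refine hm.mkQ.norm_le fun θ => ?_
      rw [← hx, ← hy]
      exact (hm'.mkQ (I := I)).dir_le θ

end QuotientComplexification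

open BoundedContinuousFunction Topology

/-! ### Representatives and the norm in the hull. -/

section HullNorm

variable {ι : Type*} {U : Ultrafilter ι} {X : Type*} [NormedAddCommGroup X] [NormedSpace ℂ X]

lemma Hull.norm_mk_le {x : finite U X} {g : ι → X} (hg : (x : Star U X) = (g : Star U X)) {r : ℝ}
    (h : ∀ᶠ i in (U : Filter ι), ‖g i‖ ≤ r) : ‖Hull.mk U X x‖ ≤ r := by
  refine ArchimedeanClass.stdPart_le_of_le (constHom U) (starNorm_finite x) ?_
  rw [hg, starNorm_coe]
  exact Germ.coe_le.2 h

lemma Hull.eventually_norm_lt {x : finite U X} {g : ι → X}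
    (hg : (x : Star U X) = (g : Star U X)) {r : ℝ} (h : ‖Hull.mk U X x‖ < r) :
    ∀ᶠ i in (U : Filter ι), ‖g i‖ < r := by
  have := ArchimedeanClass.lt_of_stdPart_lt (constHom U) (starNorm_finite x) h
  rw [hg, starNorm_coe] at this
  exact Germ.coe_lt.1 this

lemma finite.exists_bounded_rep (x : finite U X) :
    ∃ (g : ι → X) (r : ℝ), (x : Star U X) = (g : Star U X) ∧ ∀ i, ‖g i‖ ≤ r := by
  classical
  obtain ⟨x, r, hr⟩ := x
  induction x using Germ.inductionOn with
  | _ f =>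
    have h : ∀ᶠ i in (U : Filter ι), ‖f i‖ ≤ r := Germ.coe_le.1 hr
    obtain ⟨i₀, hi₀⟩ := h.exists
    refine ⟨fun i => if ‖f i‖ ≤ r then f i else 0, r, Germ.coe_eq.2 (h.mono fun i hi => ?_),
      fun i => ?_⟩
    · simp [hi]
    · dsimp only
      split_ifs with hi
      · exact hi
      · simpa using (norm_nonneg _).trans hi₀

end HullNorm

/-! ### The hull as a quotient of bounded families. -/

section BoundedFamilies

variable {L : Type*} [NormedAddCommGroup L] [NormedSpace ℝ L] [Lattice L] [IsOrderedAddMonoid L]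
  [IsOrderedModule ℝ L] [HasSolidNorm L]
  {ι : Type*} [TopologicalSpace ι] [DiscreteTopology ι]

instance : IsOrderedModule ℝ (ι →ᵇ L) := .of_smul_nonneg fun _ ht _ hf i => smul_nonneg ht (hf i)

variable {E : Type*} [NormedAddCommGroup E] [NormedSpace ℂ E] {j : L →ₗ[ℝ] E}

lemma IsComplexification.exists_isModulusPair (hj : IsComplexification j) (x y : L) :
    ∃ m, IsModulusPair x y m ∧ ‖j x + Complex.I • j y‖ = ‖m‖ := hj.norm_eq x y

lemma IsModulusPair.norm_eq (hj : IsComplexification j) {x y m : L} (h : IsModulusPair x y m) :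
    ‖j x + Complex.I • j y‖ = ‖m‖ := by
  obtain ⟨m', hm', e⟩ := hj.exists_isModulusPair x y
  rwa [h.unique hm']

lemma IsComplexification.norm_left_le (hj : IsComplexification j) (x y : L) :
    ‖x‖ ≤ ‖j x + Complex.I • j y‖ := by
  obtain ⟨m, hm, e⟩ := hj.exists_isModulusPair x y
  rw [e]
  exact norm_le_norm_of_abs_le_abs (hm.abs_left_le.trans (le_abs_self m))

lemma IsComplexification.norm_right_le (hj : IsComplexification j) (x y : L) :
    ‖y‖ ≤ ‖j x + Complex.I • j y‖ := by
  obtain ⟨m, hm, e⟩ := hj.exists_isModulusPair x y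
  rw [e]
  exact norm_le_norm_of_abs_le_abs (hm.abs_right_le.trans (le_abs_self m))

lemma IsComplexification.norm_le_add (hj : IsComplexification j) (x y : L) :
    ‖j x + Complex.I • j y‖ ≤ ‖x‖ + ‖y‖ := by
  refine (norm_add_le _ _).trans ?_
  rw [norm_smul, Complex.norm_I, one_mul, hj.norm_eq_norm, hj.norm_eq_norm]

lemma IsComplexification.exists_decomp (hj : IsComplexification j) (z : E) :
    ∃ x y, z = j x + Complex.I • j y := by
  obtain ⟨p, hp, -⟩ := hj.existsUnique_decomp z
  exact ⟨p.1, p.2, hp⟩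

/-- The modulus of a pair of bounded families is computed pointwise. -/
lemma IsComplexification.exists_isModulusPair_bounded (hj : IsComplexification j)
    (f g : ι →ᵇ L) : ∃ m : ι →ᵇ L, IsModulusPair f g m ∧ ∀ i, IsModulusPair (f i) (g i) (m i) := by
  choose m hm hn using fun i => hj.exists_isModulusPair (f i) (g i)
  refine ⟨ofNormedAddCommGroupDiscrete m (‖f‖ + ‖g‖) fun i => ?_, ⟨?_, ?_⟩, hm⟩
  · rw [← hn]
    exact (hj.norm_le_add _ _).trans (add_le_add (f.norm_coe_le_norm i) (g.norm_coe_le_norm i))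
  · rintro _ ⟨θ, rfl⟩ i
    exact (hm i).dir_le θ
  · intro u hu i
    exact (hm i).le_of_forall fun θ => hu ⟨θ, rfl⟩ i

variable (U : Ultrafilter ι)

/-- The class in the hull of `E` of a bounded family in the real part `L` of `E`. -/
def realHullMap (hj : IsComplexification j) : (ι →ᵇ L) →ₗ[ℝ] Hull U E where
  toFun f := Hull.mk U E ⟨((fun i => j (f i) : ι → E) : Star U E), ‖f‖,
    Germ.coe_le.2 (Eventually.of_forall fun i => by
      exact (hj.norm_eq_norm (f i)).trans_le (f.norm_coe_le_norm i))⟩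
  map_add' f g := by
    rw [← map_add]
    congr 1
    exact Subtype.ext (congrArg (fun g : ι → E => (g : Star U E))
      (funext fun i => map_add j (f i) (g i)))
  map_smul' r f := by
    rw [RingHom.id_apply, ← Complex.coe_smul, ← map_smul]
    congr 1
    exact Subtype.ext (congrArg (fun g : ι → E => (g : Star U E)) (funext fun i =>
      (map_smul j r (f i)).trans (Complex.coe_smul r (j (f i))).symm))

variable {U} (hj : IsComplexification j)

lemma realHullMap_add_I_smul (f g : ι →ᵇ L) : ∃ x : finite U E,
    realHullMap U hj f + Complex.I • realHullMap U hj g = Hull.mk U E x ∧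
      (x : Star U E) = ((fun i => j (f i) + Complex.I • j (g i) : ι → E) : Star U E) := by
  refine ⟨⟨((fun i => j (f i) + Complex.I • j (g i) : ι → E) : Star U E), ‖f‖ + ‖g‖,
    Germ.coe_le.2 (Eventually.of_forall fun i => ?_)⟩, ?_, rfl⟩
  · exact (hj.norm_le_add _ _).trans (add_le_add (f.norm_coe_le_norm i) (g.norm_coe_le_norm i))
  · change Hull.mk U E _ + Complex.I • Hull.mk U E _ = _
    rw [← map_smul, ← map_add]
    rfl

lemma norm_realHullMap_add_le {f g : ι →ᵇ L} {r : ℝ}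
    (h : ∀ᶠ i in (U : Filter ι), ‖j (f i) + Complex.I • j (g i)‖ ≤ r) :
    ‖realHullMap U hj f + Complex.I • realHullMap U hj g‖ ≤ r := by
  obtain ⟨x, hx, hx'⟩ := realHullMap_add_I_smul (U := U) hj f g
  rw [hx]
  exact Hull.norm_mk_le hx' h

lemma eventually_norm_lt_of_realHullMap {f g : ι →ᵇ L} {r : ℝ}
    (h : ‖realHullMap U hj f + Complex.I • realHullMap U hj g‖ < r) :
    ∀ᶠ i in (U : Filter ι), ‖j (f i) + Complex.I • j (g i)‖ < r := by
  obtain ⟨x, hx, hx'⟩ := realHullMap_add_I_smul (U := U) hj f g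
  rw [hx] at h
  exact Hull.eventually_norm_lt hx' h

lemma tendsto_zero_of_realHullMap_add_eq_zero {f g : ι →ᵇ L}
    (h : realHullMap U hj f + Complex.I • realHullMap U hj g = 0) :
    Tendsto f U (𝓝 0) ∧ Tendsto g U (𝓝 0) := by
  have key : ∀ ε > 0, ∀ᶠ i in (U : Filter ι), ‖j (f i) + Complex.I • j (g i)‖ < ε := fun ε hε =>
    eventually_norm_lt_of_realHullMap hj (by rwa [h, norm_zero])
  constructor <;> refine Metric.tendsto_nhds.2 fun ε hε => (key ε hε).mono fun i hi => ?_
  · rw [dist_zero_right]; exact (hj.norm_left_le _ _).trans_lt hi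
  · rw [dist_zero_right]; exact (hj.norm_right_le _ _).trans_lt hi

lemma norm_realHullMap_le (f : ι →ᵇ L) : ‖realHullMap U hj f‖ ≤ ‖f‖ := by
  have := norm_realHullMap_add_le (U := U) hj (f := f) (g := 0) (r := ‖f‖)
    (Eventually.of_forall fun i => by
      simpa [hj.norm_eq_norm] using f.norm_coe_le_norm i)
  simpa using this

lemma realHullMap_eq_zero_of_tendsto {f : ι →ᵇ L} (h : Tendsto f U (𝓝 0)) :
    realHullMap U hj f = 0 := by
  refine norm_le_zero_iff.1 (le_of_forall_pos_le_add fun ε hε => ?_)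
  have := norm_realHullMap_add_le (U := U) hj (f := f) (g := 0) (r := ε)
    ((Metric.tendsto_nhds.1 h ε hε).mono fun i hi => by
      simpa [hj.norm_eq_norm] using (dist_zero_right (f i) ▸ hi).le)
  simpa using this

lemma realHullMap_const (l : L) :
    realHullMap U hj (BoundedContinuousFunction.const ι l) = Hull.of U E (j l) := rfl

lemma exists_eq_realHullMap_add (z : Hull U E) : ∃ f g : ι →ᵇ L,
    z = realHullMap U hj f + Complex.I • realHullMap U hj g := by
  obtain ⟨x, rfl⟩ := Hull.mk_surjective U E z
  obtain ⟨h, r, hx, hr⟩ := finite.exists_bounded_rep x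
  choose a b hab using fun i => hj.exists_decomp (h i)
  refine ⟨ofNormedAddCommGroupDiscrete a r fun i => ?_,
    ofNormedAddCommGroupDiscrete b r fun i => ?_, ?_⟩
  · exact (hj.norm_left_le (a i) (b i)).trans (hab i ▸ hr i)
  · exact (hj.norm_right_le (a i) (b i)).trans (hab i ▸ hr i)
  · obtain ⟨y, hy, hy'⟩ := realHullMap_add_I_smul (U := U) hj
      (ofNormedAddCommGroupDiscrete a r fun i =>
        (hj.norm_left_le (a i) (b i)).trans (hab i ▸ hr i))
      (ofNormedAddCommGroupDiscrete b r fun i =>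
        (hj.norm_right_le (a i) (b i)).trans (hab i ▸ hr i))
    rw [hy]
    refine congrArg _ (Subtype.ext ?_)
    rw [hx, hy']
    exact congrArg _ (funext hab)

lemma mem_standardPart_iff {z : Hull U E} : z ∈ standardPart U E ↔ ∃ l l' : L,
    z = realHullMap U hj (BoundedContinuousFunction.const ι l) +
      Complex.I • realHullMap U hj (BoundedContinuousFunction.const ι l') := by
  constructor
  · rintro ⟨e, rfl⟩
    obtain ⟨l, l', rfl⟩ := hj.exists_decomp e
    refine ⟨l, l', ?_⟩
    rw [realHullMap_const, realHullMap_const, ← map_smul (Hull.of U E), ← map_add]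
    rfl
  · rintro ⟨l, l', rfl⟩
    rw [realHullMap_const, realHullMap_const, ← map_smul (Hull.of U E), ← map_add]
    exact ⟨_, rfl⟩

lemma tendsto_of_realHullMap_add_mem {f g : ι →ᵇ L}
    (h : realHullMap U hj f + Complex.I • realHullMap U hj g ∈ standardPart U E) :
    (∃ l, Tendsto f U (𝓝 l)) ∧ ∃ l, Tendsto g U (𝓝 l) := by
  obtain ⟨l, l', h⟩ := (mem_standardPart_iff hj).1 h
  obtain ⟨h₁, h₂⟩ := tendsto_zero_of_realHullMap_add_eq_zero (U := U) hj
    (f := f - BoundedContinuousFunction.const ι l)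
    (g := g - BoundedContinuousFunction.const ι l') (by
      rw [map_sub, map_sub, smul_sub, sub_add_sub_comm, h, sub_self])
  exact ⟨⟨l, tendsto_sub_nhds_zero_iff.1 h₁⟩, l', tendsto_sub_nhds_zero_iff.1 h₂⟩

variable (U) in
/-- The bounded families in `L` whose class in the hull is standard. -/
def convergentFamilies : Submodule ℝ (ι →ᵇ L) :=
  ((standardPart U E).restrictScalars ℝ).comap (realHullMap U hj)

lemma mem_convergentFamilies_iff {f : ι →ᵇ L} :
    f ∈ convergentFamilies U hj ↔ ∃ l, Tendsto f U (𝓝 l) := by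
  constructor
  · intro h
    have h : realHullMap U hj f ∈ standardPart U E := h
    exact (tendsto_of_realHullMap_add_mem hj (f := f) (g := 0) (by simpa using h)).1
  · rintro ⟨l, h⟩
    refine (mem_standardPart_iff hj).2 ⟨l, 0, ?_⟩
    have h₀ := realHullMap_eq_zero_of_tendsto hj (f := f - BoundedContinuousFunction.const ι l)
      (tendsto_sub_nhds_zero_iff.2 h)
    rw [map_sub, sub_eq_zero] at h₀
    have h₁ : BoundedContinuousFunction.const ι (0 : L) = 0 := rfl
    rw [h₀, h₁, map_zero, smul_zero, add_zero]

lemma mem_convergentFamilies_of_realHullMap_add_mem {f g : ι →ᵇ L}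
    (h : realHullMap U hj f + Complex.I • realHullMap U hj g ∈ standardPart U E) :
    f ∈ convergentFamilies U hj ∧ g ∈ convergentFamilies U hj := by
  rw [mem_convergentFamilies_iff, mem_convergentFamilies_iff]
  exact tendsto_of_realHullMap_add_mem hj h

instance [CompleteSpace E] : IsClosed (convergentFamilies U hj : Set (ι →ᵇ L)) := by
  have hcl : IsClosed (standardPart U E : Set (Hull U E)) := inferInstance
  exact hcl.preimage (AddMonoidHomClass.continuous_of_bound (realHullMap U hj) 1
    fun f => by simpa using norm_realHullMap_le (U := U) hj f)

/-- Let |f| ≤ |g| with g → l along U. The truncation of f to [-|l|, |l|] lives in a compact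
interval, so it converges along the ultrafilter; the remainder is bounded by ||g| - |l||, which
tends to 0. -/
lemma isLatticeIdeal_convergentFamilies (hL : CompactIntervals L) :
    IsLatticeIdeal (convergentFamilies U hj) := by
  refine ⟨fun {f g} hfg hg => ?_⟩
  rw [mem_convergentFamilies_iff] at hg ⊢
  obtain ⟨l, hl⟩ := hg
  have hK : IsCompact (Set.Icc (-|l|) |l|) := by
    refine ((hL (|l| + |l|)).image (f := fun x => x - |l|) (by fun_prop)).of_isClosed_subset
      isClosed_Icc fun x hx => ⟨x + |l|, ⟨?_, ?_⟩, by simp⟩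
    · simpa using add_le_add_left hx.1 |l|
    · exact add_le_add_left hx.2 _
  have hmem : ∀ i, trunc |l| (f i) ∈ Set.Icc (-|l|) |l| := fun i =>
    ⟨neg_le.1 ((neg_le_abs _).trans (abs_trunc_le (abs_nonneg l) _)), trunc_le (abs_nonneg l) _⟩
  obtain ⟨l', -, hl'⟩ := hK.ultrafilter_le_nhds' (U.map fun i => trunc |l| (f i))
    (Filter.univ_mem' (f := U) hmem)
  have hl' : Tendsto (fun i => trunc |l| (f i)) U (𝓝 l') := hl'
  have hdiff : Tendsto (fun i => f i - trunc |l| (f i)) U (𝓝 0) := by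
    have habs : Tendsto (fun i => ‖|g i| - |l|‖) U (𝓝 0) := by
      refine squeeze_zero (fun _ => norm_nonneg _) (fun i => norm_abs_sub_abs (g i) l) ?_
      simpa using (hl.sub_const l).norm
    refine squeeze_zero_norm (fun i => ?_) habs
    refine norm_le_norm_of_abs_le_abs (abs_sub_trunc_le (abs_nonneg l) (abs_nonneg _) ?_)
    refine (hfg i).trans ?_
    exact sub_le_iff_le_add'.1 (le_abs_self (|g i| - |l|))
  exact ⟨l', by simpa using hdiff.add hl'⟩

lemma hullCone_eq :
    Hull.cone U (j '' {x : L | 0 ≤ x}) = realHullMap U hj '' {f : ι →ᵇ L | 0 ≤ f} := by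
  classical
  ext z
  constructor
  · rintro ⟨x, hx, rfl⟩
    obtain ⟨g, r, hg, hr⟩ := finite.exists_bounded_rep x
    have hev : ∀ᶠ i in (U : Filter ι), ∃ a : L, 0 ≤ a ∧ j a = g i := by
      have hx : Germ.LiftPred (fun v => v ∈ j '' {x : L | 0 ≤ x}) (x : Star U E) := hx
      rw [hg] at hx
      exact hx
    choose a ha hag using fun i (h : ∃ a : L, 0 ≤ a ∧ j a = g i) => h
    refine ⟨ofNormedAddCommGroupDiscrete
      (fun i => if h : ∃ a : L, 0 ≤ a ∧ j a = g i then a i h else 0) r fun i => ?_, fun i => ?_, ?_⟩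
    · split_ifs with h
      · rw [← hj.norm_eq_norm, hag]; exact hr i
      · simpa using (norm_nonneg _).trans (hr i)
    · change (0 : L) ≤ if h : ∃ a : L, 0 ≤ a ∧ j a = g i then a i h else 0
      split_ifs with h
      · exact ha i h
      · exact le_rfl
    · refine congrArg _ (Subtype.ext ?_)
      rw [hg]
      refine Germ.coe_eq.2 (hev.mono fun i hi => ?_)
      change j (if h : ∃ a : L, 0 ≤ a ∧ j a = g i then a i h else 0) = g i
      rw [dif_pos hi, hag]
  · rintro ⟨f, hf, rfl⟩
    exact ⟨_, Eventually.of_forall fun i => ⟨f i, hf i, rfl⟩, rfl⟩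

variable (U) in
/-- The class in `Ẽ` of a bounded family in the real part `L` of `E`. -/
def realTildeMap : (ι →ᵇ L) →ₗ[ℝ] Tilde U E :=
  ((standardPart U E).mkQ.restrictScalars ℝ).comp (realHullMap U hj)

lemma realTildeMap_apply (f : ι →ᵇ L) :
    realTildeMap U hj f = (standardPart U E).mkQ (realHullMap U hj f) := rfl

lemma realTildeMap_add_I_smul (f g : ι →ᵇ L) :
    realTildeMap U hj f + Complex.I • realTildeMap U hj g =
      (standardPart U E).mkQ (realHullMap U hj f + Complex.I • realHullMap U hj g) := by
  rw [map_add, map_smul]; rfl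

lemma realTildeMap_eq_zero_iff {f : ι →ᵇ L} :
    realTildeMap U hj f = 0 ↔ f ∈ convergentFamilies U hj := by
  rw [realTildeMap_apply, Submodule.mkQ_apply, Submodule.Quotient.mk_eq_zero]
  rfl

lemma tildeCone_eq :
    Tilde.cone U (j '' {x : L | 0 ≤ x}) = realTildeMap U hj '' {f : ι →ᵇ L | 0 ≤ f} := by
  rw [Tilde.cone, hullCone_eq hj, Set.image_image]
  rfl

theorem isComplexBanachLattice_tilde [CompleteSpace L] [CompleteSpace E]
    (hj : IsComplexification j)     (hL : CompactIntervals L) :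
    IsComplexBanachLattice (Tilde.cone U (j '' {x : L | 0 ≤ x})) := by
  classical
  have := isLatticeIdeal_convergentFamilies (U := U) hj hL
  rw [tildeCone_eq hj]
  refine isComplexBanachLattice_image_of_ideal (convergentFamilies U hj)
    (fun f g => ?_) _ (fun z => ?_) (fun f hf => ?_) (fun f g h => ?_) (fun f g m hm => ?_)
    (fun f g r hr => ?_)
  · obtain ⟨m, hm, -⟩ := hj.exists_isModulusPair_bounded f g
    exact ⟨m, hm⟩
  · obtain ⟨w, rfl⟩ := (standardPart U E).mkQ_surjective z
    obtain ⟨f, g, rfl⟩ := exists_eq_realHullMap_add hj w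
    exact ⟨f, g, (realTildeMap_add_I_smul hj f g).symm⟩
  · exact (realTildeMap_eq_zero_iff hj).2 hf
  · rw [realTildeMap_add_I_smul, Submodule.mkQ_apply, Submodule.Quotient.mk_eq_zero] at h
    exact mem_convergentFamilies_of_realHullMap_add_mem hj h
  · obtain ⟨m', hm', hpt⟩ := hj.exists_isModulusPair_bounded f g
    obtain rfl := hm.unique hm'
    rw [realTildeMap_add_I_smul]
    refine (Submodule.Quotient.norm_mk_le _ _).trans (norm_realHullMap_add_le hj
      (Eventually.of_forall fun i => ?_))
    rw [(hpt i).norm_eq hj]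
    exact m.norm_coe_le_norm i
  · obtain ⟨w, hw, hwr⟩ := Submodule.Quotient.norm_mk_lt
      (realTildeMap U hj f + Complex.I • realTildeMap U hj g) (sub_pos.2 hr)
    rw [add_sub_cancel] at hwr
    rw [realTildeMap_add_I_smul, Submodule.mkQ_apply, Submodule.Quotient.eq] at hw
    obtain ⟨l, l', hll⟩ := (mem_standardPart_iff hj).1 hw
    have hw' : w = realHullMap U hj (f + BoundedContinuousFunction.const ι l) +
        Complex.I • realHullMap U hj (g + BoundedContinuousFunction.const ι l') := by
      rw [map_add, map_add, smul_add, add_add_add_comm, ← hll, add_sub_cancel]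
    rw [hw'] at hwr
    have hev := eventually_norm_lt_of_realHullMap hj hwr
    set S : Set ι := {i | ‖j (f i + l) + Complex.I • j (g i + l')‖ < r} with hS
    have hSU : ∀ᶠ i in (U : Filter ι), i ∈ S := hev
    -- The hull norm controls the family only on the U-large set S, but the sup norm needs every
    -- index. The correction equals l on S, so it still converges to l, and off S it cancels f
    -- outright.
    let patch : (ι →ᵇ L) → L → (ι →ᵇ L) := fun f l =>
      ofNormedAddCommGroupDiscrete (fun i => if i ∈ S then l else -f i) (‖l‖ + ‖f‖) fun i => by
        split_ifs
        · exact le_add_of_nonneg_right (norm_nonneg _)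
        · rw [norm_neg]
          exact (f.norm_coe_le_norm i).trans (le_add_of_nonneg_left (norm_nonneg _))
    have hpatch : ∀ f l i, patch f l i = if i ∈ S then l else -f i := fun _ _ _ => rfl
    have hmem : ∀ f l, patch f l ∈ convergentFamilies U hj := fun f l =>
      (mem_convergentFamilies_iff hj).2 ⟨l, tendsto_const_nhds.congr' (hSU.mono fun i hi => by
        rw [hpatch, if_pos hi])⟩
    obtain ⟨m, hm, hpt⟩ := hj.exists_isModulusPair_bounded (f + patch f l) (g + patch g l')
    refine ⟨_, hmem f l, _, hmem g l', m, hm, ?_⟩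
    have hr0 : 0 ≤ r := (norm_nonneg _).trans hr.le
    refine (BoundedContinuousFunction.norm_le hr0).2 fun i => ?_
    rw [← (hpt i).norm_eq hj, BoundedContinuousFunction.add_apply,
      BoundedContinuousFunction.add_apply, hpatch, hpatch]
    by_cases hi : i ∈ S
    · rw [if_pos hi, if_pos hi]
      exact le_of_lt hi
    · rw [if_neg hi, if_neg hi]
      simpa using hr0

/-- With w = f' + ig', the modulus of w is at most |f'| + |g'|, so every direction of z = f + ig is
bounded by this convergent family modulo convergent families. The angles 0, π, π/2 and 3π/2 then
bound |f| and |g| by elements of the ideal. -/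
theorem isOrderIdeal_standardPart (hj : IsComplexification j) (hL : CompactIntervals L) :
    IsOrderIdeal (Hull.cone U (j '' {x : L | 0 ≤ x})) (standardPart U E) := by
  have := isLatticeIdeal_convergentFamilies (U := U) hj hL
  rw [hullCone_eq hj]
  set K : Set (Hull U E) := realHullMap U hj '' {f : ι →ᵇ L | 0 ≤ f} with hK
  have hadd : ∀ {a b : Hull U E}, a ∈ K → b ∈ K → a + b ∈ K := by
    rintro _ _ ⟨f, hf, rfl⟩ ⟨g, hg, rfl⟩
    exact ⟨f + g, add_nonneg (α := ι →ᵇ L) hf hg, map_add _ _ _⟩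
  have hspan : ∀ x ∈ Submodule.span ℝ K, ∃ f, realHullMap U hj f = x := by
    intro x hx
    have : Submodule.span ℝ K ≤ LinearMap.range (realHullMap U hj) :=
      Submodule.span_le.2 (by rintro _ ⟨f, -, rfl⟩; exact ⟨f, rfl⟩)
    exact this hx
  have hle : ∀ {f g : ι →ᵇ L}, realHullMap U hj g - realHullMap U hj f ∈ K →
      ∃ i ∈ convergentFamilies U hj, f ≤ g + i := by
    rintro f g ⟨p, hp, h⟩
    refine ⟨p - (g - f), ?_, ?_⟩
    · have h₀ : realHullMap U hj (p - (g - f)) = 0 := by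
        rw [map_sub, map_sub, h, sub_self]
      change realHullMap U hj (p - (g - f)) ∈ standardPart U E
      rw [h₀]
      exact zero_mem _
    · have : g + (p - (g - f)) = f + p := by abel
      rw [this]
      exact le_add_of_nonneg_right hp
  rintro z w m n ⟨x, hx, y, hy, rfl, hzm, -⟩ ⟨x', hx', y', hy', rfl, -, hwn⟩ hnm hw
  obtain ⟨f, rfl⟩ := hspan x hx
  obtain ⟨g, rfl⟩ := hspan y hy
  obtain ⟨f', rfl⟩ := hspan x' hx'
  obtain ⟨g', rfl⟩ := hspan y' hy'
  obtain ⟨hf', hg'⟩ := mem_convergentFamilies_of_realHullMap_add_mem hj hw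
  have hh := add_mem (IsLatticeIdeal.abs_mem hf') (IsLatticeIdeal.abs_mem hg')
  have hn : realHullMap U hj (|f'| + |g'|) - n ∈ K := hwn _ fun θ =>
    ⟨|f'| + |g'| - dir θ f' g', sub_nonneg.2 (dir_le θ f' g'), by
      simp only [dir, map_sub, map_add, map_smul]⟩
  have hdir : ∀ θ, ∃ i ∈ convergentFamilies U hj, dir θ f g ≤ |f'| + |g'| + i := fun θ => by
    refine hle ?_
    have := hadd (hadd hn hnm) (hzm θ)
    rw [sub_add_sub_cancel, sub_add_sub_cancel] at this
    simpa only [dir, map_add, map_smul] using this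
  have hmem : ∀ p : ι →ᵇ L, (∃ i ∈ convergentFamilies U hj, p ≤ |f'| + |g'| + i) →
      (∃ i ∈ convergentFamilies U hj, -p ≤ |f'| + |g'| + i) → p ∈ convergentFamilies U hj := by
    rintro p ⟨i, hi, h⟩ ⟨k, hk, h'⟩
    refine IsLatticeIdeal.mem_of_abs_le (abs_le'.2 ⟨h.trans ?_, h'.trans ?_⟩)
      (add_mem hh (add_mem (IsLatticeIdeal.abs_mem hi) (IsLatticeIdeal.abs_mem hk)))
    · exact add_le_add_right ((le_abs_self i).trans (le_add_of_nonneg_right (abs_nonneg k))) _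
    · exact add_le_add_right ((le_abs_self k).trans (le_add_of_nonneg_left (abs_nonneg i))) _
  have hf : f ∈ convergentFamilies U hj :=
    hmem f (by simpa [dir] using hdir 0) (by simpa [dir] using hdir Real.pi)
  have hg : g ∈ convergentFamilies U hj := by
    refine hmem g (by simpa [dir] using hdir (Real.pi / 2)) ?_
    have := hdir (Real.pi / 2 + Real.pi)
    rw [← neg_dir] at this
    simpa [dir] using this
  exact (standardPart U E).add_mem hf ((standardPart U E).smul_mem _ hg)

/-! ### From the conditions on the hull back to compact intervals. -/

/-- If order bounded families converge along a countably incomplete ultrafilter, then order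
intervals are compact. -/
theorem CountablyIncomplete.compactIntervals (hU : CountablyIncomplete U)
    (h : ∀ (f : ι →ᵇ L) (x : L), 0 ≤ f → f ≤ BoundedContinuousFunction.const ι x →
      f ∈ convergentFamilies U hj) : CompactIntervals L := by
  classical
  obtain ⟨s, hs, hempty⟩ := hU
  have hex : ∀ i, ∃ n, i ∉ s n := fun i => by
    by_contra! hi
    exact (hempty ▸ Set.mem_iInter.2 hi : i ∈ (∅ : Set ι))
  -- The first n with i outside s n. It exceeds any bound on a finite intersection of the s k, so it
  -- tends to infinity along U.
  let N : ι → ℕ := fun i => Nat.find (hex i)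
  have hN : Tendsto N U atTop := by
    refine tendsto_atTop.2 fun n => ?_
    have : ∀ᶠ i in (U : Filter ι), ∀ k ∈ Finset.range n, i ∈ s k :=
      (Finset.eventually_all _).2 fun k _ => hs k
    refine this.mono fun i hi => (Nat.le_find_iff _ _).2 fun k hk => not_not.2 ?_
    exact hi k (Finset.mem_range.2 hk)
  intro x
  -- For a sequence w in [0, x], the family w ∘ N converges along U; as N tends to infinity, its
  -- limit is a cluster point of w and hence a subsequential limit.
  refine IsSeqCompact.isCompact fun w hw => ?_
  have hx : 0 ≤ x := (hw 0).1.trans (hw 0).2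
  obtain ⟨l, hl⟩ := (mem_convergentFamilies_iff hj).1
    (h (ofNormedAddCommGroupDiscrete (fun i => w (N i)) ‖x‖ fun i =>
        norm_le_norm_of_abs_le_abs (by
          rw [abs_of_nonneg (hw (N i)).1, abs_of_nonneg hx]; exact (hw (N i)).2)) x
      (fun i => (hw (N i)).1) (fun i => (hw (N i)).2))
  have hl : Tendsto (w ∘ N) U (𝓝 l) := hl
  refine ⟨l, isClosed_Icc.mem_of_tendsto hl (Eventually.of_forall fun i => hw (N i)), ?_⟩
  exact MapClusterPt.tendsto_subseq
    (MapClusterPt.of_comp hN hl.mapClusterPt)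

/-- The classes of f and x - f in Ẽ are positive with sum 0, because constants vanish there. In a
Banach lattice both must be 0, so f is convergent. -/
theorem mem_convergentFamilies_of_isComplexBanachLattice [CompleteSpace E]
    (h : IsComplexBanachLattice (Tilde.cone U (j '' {x : L | 0 ≤ x}))) {f : ι →ᵇ L} {x : L}
    (hf : 0 ≤ f) (hfx : f ≤ BoundedContinuousFunction.const ι x) :
    f ∈ convergentFamilies U hj := by
  obtain ⟨L', _, _, _, _, _, _, _, j', hj', hK⟩ := h
  rw [tildeCone_eq hj] at hK
  have hc : realTildeMap U hj (BoundedContinuousFunction.const ι x) = 0 :=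
    (realTildeMap_eq_zero_iff hj).2 ((mem_convergentFamilies_iff hj).2 ⟨x, tendsto_const_nhds⟩)
  obtain ⟨p, hp, hpf⟩ : realTildeMap U hj f ∈ j' '' {x : L' | 0 ≤ x} := hK ▸ ⟨f, hf, rfl⟩
  obtain ⟨p', hp', hpf'⟩ : realTildeMap U hj (BoundedContinuousFunction.const ι x - f) ∈
      j' '' {x : L' | 0 ≤ x} := hK ▸ ⟨_, sub_nonneg.2 hfx, rfl⟩
  have hsum : p + p' = 0 := by
    rw [← norm_eq_zero, ← hj'.norm_eq_norm, map_add, hpf, hpf', map_sub, hc, zero_sub,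
      add_neg_cancel, norm_zero]
  have hp0 : p = 0 := le_antisymm (by rw [← hsum]; exact le_add_of_nonneg_right hp') hp
  rw [← realTildeMap_eq_zero_iff, ← hpf, hp0, map_zero]

/-- A positive element is its own modulus, so the ideal property applies to 0 ≤ f ≤ x with x
standard. -/
theorem mem_convergentFamilies_of_isOrderIdeal
    (h : IsOrderIdeal (Hull.cone U (j '' {x : L | 0 ≤ x})) (standardPart U E)) {f : ι →ᵇ L} {x : L}
    (hf : 0 ≤ f) (hfx : f ≤ BoundedContinuousFunction.const ι x) :
    f ∈ convergentFamilies U hj := by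
  rw [hullCone_eq hj] at h
  have hmod : ∀ g : ι →ᵇ L, 0 ≤ g → IsModulus (realHullMap U hj '' {f : ι →ᵇ L | 0 ≤ f})
      (realHullMap U hj g) (realHullMap U hj g) := by
    intro g hg
    refine ⟨_, Submodule.subset_span ⟨g, hg, rfl⟩, 0, zero_mem _, by simp, fun θ => ?_,
      fun u hu => by simpa using hu 0⟩
    refine ⟨(1 - Real.cos θ) • g, smul_nonneg (sub_nonneg.2 (Real.cos_le_one θ)) hg, ?_⟩
    rw [map_smul, sub_smul, one_smul, smul_zero, add_zero]
  refine h _ _ _ _ (hmod f hf) (hmod _ (hf.trans hfx)) ⟨_, sub_nonneg.2 hfx, map_sub _ _ _⟩ ?_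
  exact (mem_convergentFamilies_iff hj).2 ⟨x, tendsto_const_nhds⟩

end BoundedFamilies

end NonstandardHull

end

theorem propositionp
    {L : Type*} [NormedAddCommGroup L] [NormedSpace ℝ L] [Lattice L] [IsOrderedAddMonoid L]
    [IsOrderedModule ℝ L] [HasSolidNorm L] [CompleteSpace L]
    {E : Type*} [NormedAddCommGroup E] [NormedSpace ℂ E] [CompleteSpace E]
    (j : L →ₗ[ℝ] E) (hj : NonstandardHull.IsComplexification j)
    {ι : Type*} (U : Ultrafilter ι) (hU : NonstandardHull.CountablyIncomplete U) :
    (NonstandardHull.IsComplexBanachLattice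
        (NonstandardHull.Tilde.cone U (j '' {x : L | 0 ≤ x})) ↔
      NonstandardHull.AtomicLattice L ∧ NonstandardHull.OrderContinuousNorm L) ∧
    (NonstandardHull.IsOrderIdeal
        (NonstandardHull.Hull.cone U (j '' {x : L | 0 ≤ x}))
        (NonstandardHull.standardPart U E) ↔
      NonstandardHull.AtomicLattice L ∧ NonstandardHull.OrderContinuousNorm L) := by
  -- With the discrete topology, `ι →ᵇ L` consists of all bounded families.
  let _ : TopologicalSpace ι := ⊥
  have : DiscreteTopology ι := ⟨rfl⟩
  rw [← NonstandardHull.compactIntervals_iff]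
  exact ⟨⟨fun h => hU.compactIntervals hj fun _ _ hf hfx =>
      NonstandardHull.mem_convergentFamilies_of_isComplexBanachLattice hj h hf hfx,
      NonstandardHull.isComplexBanachLattice_tilde hj⟩,
    ⟨fun h => hU.compactIntervals hj fun _ _ hf hfx =>
      NonstandardHull.mem_convergentFamilies_of_isOrderIdeal hj h hf hfx,
      NonstandardHull.isOrderIdeal_standardPart hj⟩⟩
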